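/- Let $\tau$ be a vocabulary consisting of relation symbols and constant symbols (possibly empty or infinite, for instance with countably many relation symbols of every arity and countably many constants) that is effectively presented: its symbols are coded by natural numbers, the sets of codes are primitive recursive, and the arity of a relation symbol is computable from its code. Formulas of dependence logic over $\tau$ are built from the literals $R(\vec t)$, $\neg R(\vec t)$, $t=t'$, $\neg\, t=t'$ (terms are variables or constants) and dependence atoms $\mathrm{dep}(y_1,\dots,y_n,z)$ ($n\ge 0$, distinct variables) by $\wedge,\vee,\forall x,\exists x$; $\forall\mathcal D(\tau)$ is the set of those in which $\exists$ does not occur. A team $T$ with domain $V$ over a $\tau$-structure $\mathcal A$ (with nonempty universe $A$) is a set of assignments $V\to A$, and $\mathcal A\models_T\varphi$ is the usual team semantics: literals hold for all $s\in T$; $\mathrm{dep}(\vec y,z)$ holds if any $s_1,s_2\in T$ that agree on $\vec y$ agree on $z$; $\wedge$ is conjunction; $\mathcal A\models_T\varphi\vee\psi$ iff $T=T_1\cup T_2$ with $\mathcal A\models_{T_1}\varphi$ and $\mathcal A\models_{T_2}\psi$; $\mathcal A\models_T\forall x\varphi$ iff $\mathcal A\models_{T'}\varphi$ for $T'=\{s[a/x]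 : s\in T, a\in A\}$; $\mathcal A\models_T\exists x\varphi$ iff there is $f\colon T\to A$ with $\mathcal A\models_{T'}\varphi$ for $T'=\{s[f(s)/x]: s\in T\}$. A formula $\varphi$ with free variables $x_1,\dots,x_n$ is $k$-coherent if for every (finite or infinite) $\tau$-structure $\mathcal A$ and every team $T$ over $\mathcal A$ with domain $\{x_1,\dots,x_n\}$, $$\mathcal A\models_T\varphi \iff \mathcal A\models_S\varphi \text{ for all } k\text{-element subteams } S\subseteq T.$$ The coherence problem for $\forall\mathcal D(\tau)$ is: given a formula $\varphi\in\forall\mathcal D(\tau)$ and an integer $k\ge 1$ (both part of the input), is $\varphi$ $k$-coherent? Theorem. The coherence problem for $\forall\mathcal D(\tau)$ is in $\mathsf{coRE}$; that is, the complement of the set of codes of pairs $(\varphi,k)$ with $\varphi\in\forall\mathcal D(\tau)$, $k\ge 1$ and $\varphi$ $k$-coherent is recursively enumerable. This holds whether "$k$-element subteam" is read as "subteam with exactly $k$ elements" or as "subteam with at most $k$ elements". -/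

import Mathlib

universe u

namespace DepLogic

/-- The countably infinite set of variables. -/
abbrev Var : Type := ℕ

/-- The terms of a vocabulary without function symbols: variables and constant symbols. -/
abbrev Term (L : FirstOrder.Language.{0, 0}) : Type := Var ⊕ L.Constants

/-- Formulas of dependence logic over the vocabulary `L`. The variables of a dependence atom
`dep(y₁, …, yₙ, z)` are pairwise distinct; `n = 0` is allowed. -/
inductive DFormula (L : FirstOrder.Language.{0, 0}) : Type
  | rel {r : ℕ} (R : L.Relations r) (ts : Fin r → Term L) : DFormula L
  | nrel {r : ℕ} (R : L.Relations r) (ts : Fin r → Term L) : DFormula L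
  | eq (t₁ t₂ : Term L) : DFormula L
  | neq (t₁ t₂ : Term L) : DFormula L
  | dep (ys : List Var) (z : Var) (distinct : (z :: ys).Nodup) : DFormula L
  | and (φ ψ : DFormula L) : DFormula L
  | or (φ ψ : DFormula L) : DFormula L
  | all (x : Var) (φ : DFormula L) : DFormula L
  | ex (x : Var) (φ : DFormula L) : DFormula L

variable {L : FirstOrder.Language.{0, 0}}

/-- The variables that occur in a term. -/
def termVars : Term L → Finset Var
  | Sum.inl x => {x}
  | Sum.inr _ => ∅

/-- The free variables of a formula. -/
def DFormula.freeVars : DFormula L → Finset Var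
  | .rel _ ts => Finset.univ.biUnion fun i => termVars (ts i)
  | .nrel _ ts => Finset.univ.biUnion fun i => termVars (ts i)
  | .eq t₁ t₂ => termVars t₁ ∪ termVars t₂
  | .neq t₁ t₂ => termVars t₁ ∪ termVars t₂
  | .dep ys z _ => (z :: ys).toFinset
  | .and φ ψ => φ.freeVars ∪ ψ.freeVars
  | .or φ ψ => φ.freeVars ∪ ψ.freeVars
  | .all x φ => φ.freeVars.erase x
  | .ex x φ => φ.freeVars.erase x

/-- The universal formulas: those in which `∃` does not occur. -/
def DFormula.IsUniversal : DFormula L → Prop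
  | .rel _ _ => True
  | .nrel _ _ => True
  | .eq _ _ => True
  | .neq _ _ => True
  | .dep _ _ _ => True
  | .and φ ψ => φ.IsUniversal ∧ ψ.IsUniversal
  | .or φ ψ => φ.IsUniversal ∧ ψ.IsUniversal
  | .all _ φ => φ.IsUniversal
  | .ex _ _ => False

/-- An assignment with range `A` is a partial function from variables to `A`; its domain is the
set of variables on which it is not `none`. -/
abbrev Assignment (A : Type u) : Type u := Var → Option A

/-- A team is a set of assignments (see `HasDomain` for the common domain). -/
abbrev Team (A : Type u) : Type u := Set (Assignment A)

/-- `T` is a team with domain `V`: every assignment in `T` has domain exactly `V`. -/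
def HasDomain {A : Type u} (T : Team A) (V : Set Var) : Prop :=
  ∀ s ∈ T, ∀ x, (s x).isSome ↔ x ∈ V

/-- The assignment `s[a/x]`, whose domain is the domain of `s` together with `x`. -/
def assign {A : Type u} (s : Assignment A) (x : Var) (a : A) : Assignment A :=
  Function.update s x (some a)

/-- The value of a term under an assignment (`none` only for a variable outside the domain). -/
def termVal {A : Type u} [L.Structure A] (s : Assignment A) : Term L → Option A
  | Sum.inl x => s x
  | Sum.inr c => some (c : A)

/-- Team semantics: `Sat φ T` says that the team `T` satisfies `φ` in the structure `A`. It is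
only used for teams whose domain contains the free variables of `φ`. -/
def Sat {A : Type u} [L.Structure A] : DFormula L → Team A → Prop
  | .rel R ts, T =>
      ∀ s ∈ T, ∃ v, (∀ i, termVal s (ts i) = some (v i)) ∧ FirstOrder.Language.Structure.RelMap R v
  | .nrel R ts, T =>
      ∀ s ∈ T, ∃ v, (∀ i, termVal s (ts i) = some (v i)) ∧ ¬ FirstOrder.Language.Structure.RelMap R v
  | .eq t₁ t₂, T => ∀ s ∈ T, termVal s t₁ = termVal s t₂
  | .neq t₁ t₂, T => ∀ s ∈ T, termVal s t₁ ≠ termVal s t₂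
  | .dep ys z _, T => ∀ s₁ ∈ T, ∀ s₂ ∈ T, (∀ y ∈ ys, s₁ y = s₂ y) → s₁ z = s₂ z
  | .and φ ψ, T => Sat φ T ∧ Sat ψ T
  | .or φ ψ, T => ∃ T₁ T₂ : Team A, T = T₁ ∪ T₂ ∧ Sat φ T₁ ∧ Sat ψ T₂
  | .all x φ, T => Sat φ {s' | ∃ s ∈ T, ∃ a : A, s' = assign s x a}
  | .ex x φ, T => ∃ f : T → A, Sat φ {s' | ∃ s : T, s' = assign s.1 x (f s)}

/-- `φ` is `k`-coherent: in every (finite or infinite) structure, a team whose domain is the set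
of free variables of `φ` satisfies `φ` iff all its subteams with exactly `k` elements do. -/
def KCoherent (φ : DFormula L) (k : ℕ) : Prop :=
  ∀ (A : Type u) [Nonempty A] [L.Structure A] (T : Team A), HasDomain T φ.freeVars →
    (Sat φ T ↔ ∀ S ⊆ T, S.encard = k → Sat φ S)

/-- The variant of `KCoherent` in which the subteams have at most `k` elements. -/
def KCoherentAtMost (φ : DFormula L) (k : ℕ) : Prop :=
  ∀ (A : Type u) [Nonempty A] [L.Structure A] (T : Team A), HasDomain T φ.freeVars →
    (Sat φ T ↔ ∀ S ⊆ T, S.encard ≤ k → Sat φ S)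

/-- The natural number that codes a formula, given codes for the symbols of the vocabulary. -/
def DFormula.code [Encodable L.Constants] [Encodable (Σ r, L.Relations r)] : DFormula L → ℕ
  | .rel (r := r) R ts =>
      Nat.pair 0 (Encodable.encode ((⟨r, R⟩ : Σ r, L.Relations r), List.ofFn ts))
  | .nrel (r := r) R ts =>
      Nat.pair 1 (Encodable.encode ((⟨r, R⟩ : Σ r, L.Relations r), List.ofFn ts))
  | .eq t₁ t₂ => Nat.pair 2 (Encodable.encode (t₁, t₂))
  | .neq t₁ t₂ => Nat.pair 3 (Encodable.encode (t₁, t₂))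
  | .dep ys z _ => Nat.pair 4 (Encodable.encode (ys, z))
  | .and φ ψ => Nat.pair 5 (Nat.pair φ.code ψ.code)
  | .or φ ψ => Nat.pair 6 (Nat.pair φ.code ψ.code)
  | .all x φ => Nat.pair 7 (Nat.pair x φ.code)
  | .ex x φ => Nat.pair 8 (Nat.pair x φ.code)

/-- Distinct formulas have distinct codes. -/
theorem DFormula.code_injective [Encodable L.Constants] [Encodable (Σ r, L.Relations r)] :
    Function.Injective (DFormula.code (L := L)) := by
  intro φ
  induction φ with
  | rel R ts =>
    intro ψ h
    cases ψ <;> simp only [code, Nat.pair_eq_pair, Encodable.encode_inj, Prod.mk.injEq,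
      Sigma.mk.injEq] at h <;> try omega
    obtain ⟨-, ⟨rfl, h₁⟩, h₂⟩ := h
    rw [eq_of_heq h₁, List.ofFn_injective h₂]
  | nrel R ts =>
    intro ψ h
    cases ψ <;> simp only [code, Nat.pair_eq_pair, Encodable.encode_inj, Prod.mk.injEq,
      Sigma.mk.injEq] at h <;> try omega
    obtain ⟨-, ⟨rfl, h₁⟩, h₂⟩ := h
    rw [eq_of_heq h₁, List.ofFn_injective h₂]
  | eq t₁ t₂ | neq t₁ t₂ | dep ys z hd =>
    intro ψ h
    cases ψ <;> simp_all [code, Nat.pair_eq_pair]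
  | and φ ψ ih₁ ih₂ | or φ ψ ih₁ ih₂ =>
    intro χ h
    cases χ <;> simp only [code, Nat.pair_eq_pair] at h <;> try omega
    rw [ih₁ h.2.1, ih₂ h.2.2]
  | all x φ ih | ex x φ ih =>
    intro χ h
    cases χ <;> simp only [code, Nat.pair_eq_pair] at h <;> try omega
    rw [h.2.1, ih h.2.2]

/-- The coherence problem for a collection `F` of formulas and a notion `C` of `k`-coherence:
given a formula `φ` in `F` and a positive integer `k`, is `φ` `k`-coherent? As usual, it is the
set of (codes of) the yes-instances. -/
def CoherenceProblem [Encodable L.Constants] [Encodable (Σ r, L.Relations r)]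
    (F : Set (DFormula L)) (C : DFormula L → ℕ → Prop) : Set ℕ :=
  {n | ∃ φ ∈ F, ∃ k : ℕ, 1 ≤ k ∧ C φ k ∧ n = Nat.pair φ.code k}

/-- A problem is in coRE if its complement is recursively enumerable. -/
def IsCoRE (Q : Set ℕ) : Prop := REPred fun n => n ∉ Q

/-- The universal formulas of dependence logic over `L`. -/
def universalFormulas (L : FirstOrder.Language.{0, 0}) : Set (DFormula L) := {φ | φ.IsUniversal}

end DepLogic

/-!
Satisfaction of a universal formula passes to subteams and to smaller universes, so such a formula
fails to be `k`-coherent exactly if some team falsifies it although all the relevant subteams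
satisfy it. This can be detected in finite structures. By compactness, a universal formula that
fails in a team of assignments with finite domain fails already in the part of the team with values
in some finite set `B`, with quantifiers restricted to `B` (`exists_finset_not_satIn`). The reason
is that team semantics of universal formulas is existential only in the splittings of teams at
disjunctions, and an ultralimit of splittings is a splitting (`SatIn.ultralimit`). The small
subteams, on the other hand, keep satisfying the formula when the universe shrinks to `B`
(`SatIn.mono`). Only the finitely many symbols of the formula matter, so a counterexample to
coherence is a finite object.

Finite structures and teams are coded by lists of numbers. For a given structure `goodTeams`
computes, by course-of-values recursion on the code of a formula, a finite list of teams whose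
subteams are the teams satisfying the formula (`satIn_iff_exists_goodTeams`). Hence "`w` codes a
counterexample to the `k`-coherence of `φ`" is a primitive recursive property of `w`, `k` and the
code of `φ`. Teams in a counterexample may carry variables that are not free in `φ`:
satisfaction depends only on the restriction to the free variables, and every `k`-element subset of
the restricted team is the restriction of a `k`-element subset of the team. So the free variables
need not be computed.

Whether a number is the code of a universal formula at all is decidable (`isUniversalCode_iff`);
this is the only place where the arity function is used. The complement of the coherence problem
is therefore the union of a decidable set and the projection of a primitive recursive one.
-/

namespace DepLogic

open Encodable

/-! ### Closure properties of primitive recursive predicates and of enumerability -/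

section Recursive

variable {α β σ : Type*} [Primcodable α] [Primcodable β] [Primcodable σ]

theorem primrecPred_ball {f : α → List β} {p : α → β → Prop} (hf : Primrec f)
    (hp : PrimrecPred fun x : α × β => p x.1 x.2) : PrimrecPred fun a => ∀ b ∈ f a, p a b := by
  have h : PrimrecRel fun (b : β) (a : α) => p a b := hp.comp (Primrec.snd.pair Primrec.fst)
  exact h.forall_mem_list.comp hf Primrec.id

theorem primrecPred_bex {f : α → List β} {p : α → β → Prop} (hf : Primrec f)
    (hp : PrimrecPred fun x : α × β => p x.1 x.2) : PrimrecPred fun a => ∃ b ∈ f a, p a b := by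
  have h : PrimrecRel fun (b : β) (a : α) => p a b := hp.comp (Primrec.snd.pair Primrec.fst)
  exact h.exists_mem_list.comp hf Primrec.id

theorem primrecPred_mem {f : α → β} {g : α → List β} (hf : Primrec f) (hg : Primrec g) :
    PrimrecPred fun a => f a ∈ g a :=
  (primrecPred_bex (p := fun a b => b = f a) hg
    (Primrec.eq.comp Primrec.snd (hf.comp Primrec.fst))).of_eq fun a => by simp

theorem primrecPred_subset {f g : α → List β} (hf : Primrec f) (hg : Primrec g) :
    PrimrecPred fun a => f a ⊆ g a :=
  primrecPred_ball (p := fun a b => b ∈ g a) hf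
    (primrecPred_mem Primrec.snd (hg.comp Primrec.fst))

theorem primrecPred_imp {p q : α → Prop} (hp : PrimrecPred p) (hq : PrimrecPred q) :
    PrimrecPred fun a => p a → q a :=
  (hp.not.or hq).of_eq fun a => by tauto

theorem primrec_filter {f : α → List β} {p : α → β → Prop} [∀ a, DecidablePred (p a)]
    (hf : Primrec f) (hp : PrimrecPred fun x : α × β => p x.1 x.2) :
    Primrec fun a => (f a).filter fun b => p a b := by
  have h : PrimrecRel fun (b : β) (a : α) => p a b := hp.comp (Primrec.snd.pair Primrec.fst)
  exact h.listFilter.comp hf Primrec.id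

theorem primrec_sublists' : Primrec (List.sublists' : List α → List (List α)) := by
  have h : Primrec fun l : List α =>
      l.foldr (fun a acc => acc ++ acc.map (List.cons a)) [[]] :=
    Primrec.list_foldr
      (h := fun (_ : List α) (x : α × List (List α)) => x.2 ++ x.2.map (List.cons x.1))
      Primrec.id
      (Primrec.const _)
      (Primrec.list_append.comp (Primrec.snd.comp Primrec.snd)
        (Primrec.list_map (Primrec.snd.comp Primrec.snd)
          (g := fun (x : List α × α × List (List α)) l => x.2.1 :: l)
          (Primrec.list_cons.comp (Primrec.fst.comp (Primrec.snd.comp Primrec.fst))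
            Primrec.snd).to₂)).to₂
  refine h.of_eq fun l => ?_
  induction l with
  | nil => rfl
  | cons a l ih => rw [List.foldr_cons, ih, List.sublists'_cons]

theorem rePred_exists {p : α → β → Prop} (hp : PrimrecPred fun x : α × β => p x.1 x.2) :
    REPred fun a => ∃ b, p a b := by
  classical
  have hb : Primrec₂ fun (a : α) (n : ℕ) =>
      (decode (α := β) n).bind fun b => if p a b then some () else none :=
    Primrec.option_bind (Primrec.decode.comp Primrec.snd)
      (Primrec.ite (hp.comp ((Primrec.fst.comp Primrec.fst).pair Primrec.snd))
        (Primrec.const _) (Primrec.const _))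
  refine (Partrec.rfindOpt hb.to_comp).dom_re.of_eq fun a => ?_
  rw [Nat.rfindOpt_dom]
  constructor
  · rintro ⟨n, u, h⟩
    obtain ⟨b, -, hb⟩ := Option.bind_eq_some_iff.1 h
    by_contra! hc
    simp [hc b] at hb
  · rintro ⟨b, h⟩
    exact ⟨encode b, (), by simp [h]⟩

theorem rePred_or {p q : α → Prop} (hp : REPred p) (hq : REPred q) :
    REPred fun a => p a ∨ q a := by
  obtain ⟨k, hk, H⟩ := Partrec.merge' hp hq
  exact hk.dom_re.of_eq fun a => (H a).2.trans (by simp [Part.assert])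

/-- The list of the values at `0, …, n - 1` of the function defined by course-of-values recursion
with step `g`; the step receives the list of all earlier values. -/
def covTable (g : α → List σ → σ) (a : α) : ℕ → List σ
  | 0 => []
  | n + 1 => covTable g a n ++ [g a (covTable g a n)]

@[simp] theorem length_covTable {α σ : Type*} (g : α → List σ → σ) (a : α) (n : ℕ) :
    (covTable g a n).length = n := by
  induction n with
  | zero => rfl
  | succ n ih => simp [covTable, ih]

theorem getElem?_covTable {α σ : Type*} (g : α → List σ → σ) (a : α) {m n : ℕ} (h : m < n) :
    (covTable g a n)[m]? = some (g a (covTable g a m)) := by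
  induction n with
  | zero => omega
  | succ n ih =>
    rw [covTable]
    rcases Nat.lt_succ_iff_lt_or_eq.1 h with h | rfl
    · rw [List.getElem?_append_left (by simpa using h), ih h]
    · rw [List.getElem?_append_right (by simp)]
      simp

theorem primrec_covTable {g : α → List σ → σ} (hg : Primrec₂ g) : Primrec₂ (covTable g) := by
  refine (Primrec.nat_rec (f := fun _ : α => ([] : List σ))
    (g := fun a x => x.2 ++ [g a x.2]) (Primrec.const _)
    (Primrec.list_concat.comp (Primrec.snd.comp Primrec.snd)
      (hg.comp Primrec.fst (Primrec.snd.comp Primrec.snd)))).of_eq fun x n => ?_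
  induction n with
  | zero => rfl
  | succ n ih => simp only [covTable, ← ih]

theorem computable_covTable {g : α → List σ → σ} (hg : Computable₂ g) :
    Computable₂ (covTable g) := by
  refine (Computable.nat_rec (f := fun x : α × ℕ => x.2) (g := fun _ => ([] : List σ))
    (h := fun x y => y.2 ++ [g x.1 y.2]) Computable.snd (Computable.const _)
    (Computable.list_concat.comp (Computable.snd.comp Computable.snd)
      (hg.comp (Computable.fst.comp Computable.fst)
        (Computable.snd.comp Computable.snd)))).of_eq fun ⟨x, n⟩ => ?_
  induction n with
  | zero => rfl
  | succ n ih => simp only [covTable] at ih ⊢; rw [← ih]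

end Recursive

/-! ### Evaluation of coded formulas in coded finite structures -/

/-- The lists of length `b` with entries at most `N`: the assignments of elements of the universe
`{0, …, N}` to the variables below `b`. -/
def tuples (N : ℕ) : ℕ → List (List ℕ)
  | 0 => [[]]
  | b + 1 => (tuples N b).flatMap fun l => (List.range (N + 1)).map fun a => a :: l

theorem mem_tuples {N b : ℕ} {l : List ℕ} :
    l ∈ tuples N b ↔ l.length = b ∧ ∀ a ∈ l, a ≤ N := by
  induction b generalizing l with
  | zero => simp +contextual [tuples, List.length_eq_zero_iff]
  | succ b ih =>
    cases l with
    | nil => simp [tuples]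
    | cons a l => simp [tuples, ih]; tauto

/-- A code of a finite structure with universe `{0, …, N}`: the number `N`, the list of the values
of the constants, indexed by the codes of the constants, and the list of the true atoms, each
given by the code of its relation symbol and the values of its arguments. -/
abbrev ModelCode : Type := ℕ × List ℕ × List (ℕ × List ℕ)

/-- The value under the assignment `l` of the term with code `t`: an even code `2 * x` stands for
the variable `x`, an odd code `2 * c + 1` for the constant with code `c`. Values of constants are
truncated to the universe. -/
def codeVal (M : ModelCode) (l : List ℕ) (t : ℕ) : ℕ :=
  if t % 2 = 0 then l.getD (t / 2) 0 else min (M.2.1.getD (t / 2) 0) M.1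

/-- The list of natural numbers with a given code. -/
def listOfCode (n : ℕ) : List ℕ := (decode n : Option (List ℕ)).getD []

/-- One step of the evaluation of formulas on the assignments in `p.2` over the structure `p.1`.
The formula has the code `prev.length`, and `prev` lists the results for the smaller codes. The
result is a list of teams such that the teams satisfying the formula are exactly the subteams of
its members. The cases follow the tags in `DFormula.code`; the last one, for `∀`, also receives the
numbers that are not codes of universal formulas, on which the value is irrelevant. -/
def evalStep (p : ModelCode × List (List ℕ)) (prev : List (List (List (List ℕ)))) :
    List (List (List ℕ)) :=
  let q := prev.length.unpair.2
  if prev.length.unpair.1 = 0 then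
    [p.2.filter fun l =>
      (q.unpair.1, (listOfCode q.unpair.2).map fun t => codeVal p.1 l t) ∈ p.1.2.2]
  else if prev.length.unpair.1 = 1 then
    [p.2.filter fun l =>
      (q.unpair.1, (listOfCode q.unpair.2).map fun t => codeVal p.1 l t) ∉ p.1.2.2]
  else if prev.length.unpair.1 = 2 then
    [p.2.filter fun l => codeVal p.1 l q.unpair.1 = codeVal p.1 l q.unpair.2]
  else if prev.length.unpair.1 = 3 then
    [p.2.filter fun l => codeVal p.1 l q.unpair.1 ≠ codeVal p.1 l q.unpair.2]
  else if prev.length.unpair.1 = 4 then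
    p.2.sublists'.filter fun X => ∀ l ∈ X, ∀ l' ∈ X,
      (∀ y ∈ listOfCode q.unpair.1, l.getD y 0 = l'.getD y 0) →
        l.getD q.unpair.2 0 = l'.getD q.unpair.2 0
  else if prev.length.unpair.1 = 5 then
    (prev.getD q.unpair.1 []).flatMap fun X =>
      (prev.getD q.unpair.2 []).map fun Y => X.filter fun l => l ∈ Y
  else if prev.length.unpair.1 = 6 then
    (prev.getD q.unpair.1 []).flatMap fun X => (prev.getD q.unpair.2 []).map fun Y => X ++ Y
  else
    (prev.getD q.unpair.2 []).map fun X =>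
      p.2.filter fun l => ∀ a ∈ List.range (p.1.1 + 1), l.set q.unpair.1 a ∈ X

/-- A list of teams such that the teams of assignments in `As` satisfying the formula with code
`n` in the structure `M` are exactly the subteams of its members. -/
def goodTeams (M : ModelCode) (As : List (List ℕ)) (n : ℕ) : List (List (List ℕ)) :=
  evalStep (M, As) (covTable evalStep (M, As) n)

theorem primrec_listOfCode : Primrec listOfCode :=
  Primrec.option_getD.comp Primrec.decode (Primrec.const [])

theorem primrec_codeVal :
    Primrec fun x : (ModelCode × List ℕ) × ℕ => codeVal x.1.1 x.1.2 x.2 := by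
  have ht : Primrec fun x : (ModelCode × List ℕ) × ℕ => x.2 / 2 :=
    Primrec.nat_div.comp Primrec.snd (Primrec.const 2)
  have hM : Primrec fun x : (ModelCode × List ℕ) × ℕ => x.1.1 := Primrec.fst.comp Primrec.fst
  exact Primrec.ite
    (Primrec.eq.comp (Primrec.nat_mod.comp Primrec.snd (Primrec.const 2)) (Primrec.const 0))
    ((Primrec.list_getD 0).comp (Primrec.snd.comp Primrec.fst) ht)
    (Primrec.nat_min.comp
      ((Primrec.list_getD 0).comp (Primrec.fst.comp (Primrec.snd.comp hM)) ht)
      (Primrec.fst.comp hM))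

theorem primrec_codeVal_comp {α : Type*} [Primcodable α] {M : α → ModelCode} {l : α → List ℕ}
    {t : α → ℕ} (hM : Primrec M) (hl : Primrec l) (ht : Primrec t) :
    Primrec fun a => codeVal (M a) (l a) (t a) :=
  primrec_codeVal.comp ((hM.pair hl).pair ht)

theorem primrec_set_comp {α : Type*} [Primcodable α] {l : α → List ℕ} {i v : α → ℕ}
    (hl : Primrec l) (hi : Primrec i) (hv : Primrec v) :
    Primrec fun a => (l a).set (i a) (v a) :=
  Primrec.list_set.comp hl (hi.pair hv)

theorem primrec_tuples : Primrec₂ tuples := by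
  refine (Primrec.nat_rec (f := fun _ : ℕ => [([] : List ℕ)])
    (g := fun N x => x.2.flatMap fun l => (List.range (N + 1)).map fun a => a :: l)
    (Primrec.const _) ?_).of_eq fun N b => ?_
  · refine Primrec.list_flatMap (Primrec.snd.comp Primrec.snd) ?_
    exact Primrec.list_map
      (Primrec.list_range.comp (Primrec.succ.comp (Primrec.fst.comp Primrec.fst)))
      (Primrec.list_cons.comp Primrec.snd (Primrec.snd.comp Primrec.fst)).to₂
  · induction b with
    | zero => rfl
    | succ b ih => simp only [tuples, ← ih]

theorem primrec_evalStep : Primrec₂ evalStep := by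
  let I := (ModelCode × List (List ℕ)) × List (List (List (List ℕ)))
  have hn : Primrec fun x : I => x.2.length.unpair :=
    Primrec.unpair.comp (Primrec.list_length.comp Primrec.snd)
  have hq : Primrec fun x : I => x.2.length.unpair.2.unpair :=
    Primrec.unpair.comp (Primrec.snd.comp hn)
  have hq1 : Primrec fun x : I => x.2.length.unpair.2.unpair.1 := Primrec.fst.comp hq
  have hq2 : Primrec fun x : I => x.2.length.unpair.2.unpair.2 := Primrec.snd.comp hq
  have hAs : Primrec fun x : I => x.1.2 := Primrec.snd.comp Primrec.fst
  have hM : Primrec fun x : I => x.1.1 := Primrec.fst.comp Primrec.fst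
  have hD : Primrec fun x : I => x.1.1.2.2 := Primrec.snd.comp (Primrec.snd.comp hM)
  have tag (i : ℕ) : PrimrecPred fun x : I => x.2.length.unpair.1 = i :=
    Primrec.eq.comp (Primrec.fst.comp hn) (Primrec.const i)
  have atom : PrimrecPred fun x : I × List ℕ => (x.1.2.length.unpair.2.unpair.1,
      (listOfCode x.1.2.length.unpair.2.unpair.2).map fun t => codeVal x.1.1.1 x.2 t)
        ∈ x.1.1.1.2.2 :=
    primrecPred_mem
      ((hq1.comp Primrec.fst).pair
        (Primrec.list_map (primrec_listOfCode.comp (hq2.comp Primrec.fst))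
          (primrec_codeVal_comp (hM.comp (Primrec.fst.comp Primrec.fst))
            (Primrec.snd.comp Primrec.fst) Primrec.snd).to₂))
      (hD.comp Primrec.fst)
  have eqn : PrimrecPred fun x : I × List ℕ =>
      codeVal x.1.1.1 x.2 x.1.2.length.unpair.2.unpair.1 =
        codeVal x.1.1.1 x.2 x.1.2.length.unpair.2.unpair.2 :=
    Primrec.eq.comp
      (primrec_codeVal_comp (hM.comp Primrec.fst) Primrec.snd (hq1.comp Primrec.fst))
      (primrec_codeVal_comp (hM.comp Primrec.fst) Primrec.snd (hq2.comp Primrec.fst))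
  have single {p : I → List ℕ → Prop} [∀ x, DecidablePred (p x)]
      (hp : PrimrecPred fun x : I × List ℕ => p x.1 x.2) :
      Primrec fun x : I => [x.1.2.filter fun l => p x l] :=
    Primrec.list_cons.comp (primrec_filter hAs hp) (Primrec.const [])
  have lookup {f : I → ℕ} (hf : Primrec f) : Primrec fun x : I => x.2.getD (f x) [] :=
    (Primrec.list_getD []).comp Primrec.snd hf
  refine Primrec.ite (tag 0) (single atom) <| Primrec.ite (tag 1) (single atom.not) <|
    Primrec.ite (tag 2) (single eqn) <| Primrec.ite (tag 3) (single eqn.not) <|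
    Primrec.ite (tag 4) ?_ <| Primrec.ite (tag 5) ?_ <| Primrec.ite (tag 6) ?_ ?_
  · refine primrec_filter (primrec_sublists'.comp hAs) ?_
    refine primrecPred_ball Primrec.snd (primrecPred_ball (Primrec.snd.comp Primrec.fst) ?_)
    have hx : Primrec fun x : ((I × List (List ℕ)) × List ℕ) × List ℕ => x.1.1.1 :=
      Primrec.fst.comp (Primrec.fst.comp Primrec.fst)
    have hl : Primrec fun x : ((I × List (List ℕ)) × List ℕ) × List ℕ => x.1.2 :=
      Primrec.snd.comp Primrec.fst
    refine primrecPred_imp (primrecPred_ball (primrec_listOfCode.comp (hq1.comp hx)) ?_) ?_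
    · exact Primrec.eq.comp
        ((Primrec.list_getD 0).comp (hl.comp Primrec.fst) Primrec.snd)
        ((Primrec.list_getD 0).comp (Primrec.snd.comp Primrec.fst) Primrec.snd)
    · exact Primrec.eq.comp ((Primrec.list_getD 0).comp hl (hq2.comp hx))
        ((Primrec.list_getD 0).comp Primrec.snd (hq2.comp hx))
  · refine Primrec.list_flatMap (lookup hq1) ?_
    refine Primrec.list_map ((lookup hq2).comp Primrec.fst) ?_
    exact primrec_filter (Primrec.snd.comp Primrec.fst)
      (primrecPred_mem Primrec.snd (Primrec.snd.comp Primrec.fst))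
  · refine Primrec.list_flatMap (lookup hq1) ?_
    refine Primrec.list_map ((lookup hq2).comp Primrec.fst) ?_
    exact Primrec.list_append.comp (Primrec.snd.comp Primrec.fst) Primrec.snd
  · refine Primrec.list_map (lookup hq2) ?_
    refine primrec_filter (hAs.comp Primrec.fst) ?_
    refine primrecPred_ball
      (Primrec.list_range.comp (Primrec.succ.comp
        (Primrec.fst.comp (hM.comp (Primrec.fst.comp Primrec.fst))))) ?_
    have hx : Primrec fun x : ((I × List (List ℕ)) × List ℕ) × ℕ => x.1.1.1 :=
      Primrec.fst.comp (Primrec.fst.comp Primrec.fst)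
    have hs : Primrec fun x : ((I × List (List ℕ)) × List ℕ) × ℕ =>
        x.1.2.set x.1.1.1.2.length.unpair.2.unpair.1 x.2 :=
      primrec_set_comp (Primrec.snd.comp Primrec.fst) (hq1.comp hx) Primrec.snd
    exact primrecPred_mem hs (Primrec.snd.comp (Primrec.fst.comp Primrec.fst))

theorem primrec_goodTeams {α : Type*} [Primcodable α] {M : α → ModelCode}
    {As : α → List (List ℕ)} {n : α → ℕ} (hM : Primrec M) (hAs : Primrec As) (hn : Primrec n) :
    Primrec fun a => goodTeams (M a) (As a) (n a) :=
  primrec_evalStep.comp (hM.pair hAs)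
    ((primrec_covTable primrec_evalStep).comp (hM.pair hAs) hn)

variable {L : FirstOrder.Language.{0, 0}}

/-! ### Team semantics relative to a subset of the universe -/

/-- Team semantics of universal formulas with the universal quantifiers ranging over `B` only. The
teams are not required to have values in `B`. In a disjunction the team need only be covered by
the two teams, which makes no difference because satisfaction passes to subteams. The value at `∃` is
irrelevant. -/
def SatIn {A : Type u} [L.Structure A] (B : Set A) : DFormula L → Team A → Prop
  | .and φ ψ, T => SatIn B φ T ∧ SatIn B ψ T
  | .or φ ψ, T => ∃ T₁ T₂ : Team A, T ⊆ T₁ ∪ T₂ ∧ SatIn B φ T₁ ∧ SatIn B ψ T₂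
  | .all x φ, T => SatIn B φ {s' | ∃ s ∈ T, ∃ a ∈ B, s' = assign s x a}
  | φ, T => Sat φ T

theorem SatIn.mono {A : Type u} [L.Structure A] {B B' : Set A} (hB : B' ⊆ B) {φ : DFormula L}
    (hφ : φ.IsUniversal) {T T' : Team A} (hT : T' ⊆ T) (h : SatIn B φ T) : SatIn B' φ T' := by
  induction φ generalizing T T' with
  | rel R ts | nrel R ts | eq t₁ t₂ | neq t₁ t₂ => exact fun s hs => h s (hT hs)
  | dep ys z hd => exact fun s₁ h₁ s₂ h₂ => h s₁ (hT h₁) s₂ (hT h₂)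
  | and φ ψ ih₁ ih₂ => exact ⟨ih₁ hφ.1 hT h.1, ih₂ hφ.2 hT h.2⟩
  | or φ ψ ih₁ ih₂ =>
    obtain ⟨T₁, T₂, hU, h₁, h₂⟩ := h
    exact ⟨T₁, T₂, hT.trans hU, ih₁ hφ.1 subset_rfl h₁, ih₂ hφ.2 subset_rfl h₂⟩
  | all x φ ih =>
    refine ih hφ ?_ h
    rintro _ ⟨s, hs, a, ha, rfl⟩
    exact ⟨s, hT hs, a, hB ha, rfl⟩
  | ex x φ ih => exact hφ.elim

theorem satIn_univ {A : Type u} [L.Structure A] {φ : DFormula L} (hφ : φ.IsUniversal)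
    {T : Team A} : SatIn Set.univ φ T ↔ Sat φ T := by
  induction φ generalizing T with
  | rel R ts | nrel R ts | eq t₁ t₂ | neq t₁ t₂ | dep ys z hd => exact Iff.rfl
  | and φ ψ ih₁ ih₂ => exact and_congr (ih₁ hφ.1) (ih₂ hφ.2)
  | or φ ψ ih₁ ih₂ =>
    constructor
    · rintro ⟨T₁, T₂, hU, h₁, h₂⟩
      refine ⟨T ∩ T₁, T ∩ T₂, ?_, (ih₁ hφ.1).1 (h₁.mono subset_rfl hφ.1 Set.inter_subset_right),
        (ih₂ hφ.2).1 (h₂.mono subset_rfl hφ.2 Set.inter_subset_right)⟩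
      rw [← Set.inter_union_distrib_left, Set.inter_eq_left.2 hU]
    · rintro ⟨T₁, T₂, hU, h₁, h₂⟩
      exact ⟨T₁, T₂, hU.subset, (ih₁ hφ.1).2 h₁, (ih₂ hφ.2).2 h₂⟩
  | all x φ ih => simpa [SatIn, Sat] using ih hφ
  | ex x φ ih => exact hφ.elim

theorem Sat.mono {A : Type u} [L.Structure A] {φ : DFormula L} (hφ : φ.IsUniversal)
    {T T' : Team A} (hT : T' ⊆ T) (h : Sat φ T) : Sat φ T' :=
  (satIn_univ hφ).1 (((satIn_univ hφ).2 h).mono subset_rfl hφ hT)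

/-- Satisfaction of universal formulas passes to ultralimits of teams, the universal quantifiers
ranging over the limit of the universes. The two halves of a disjunction are preserved because an
ultrafilter that contains a union of two sets contains one of them. -/
theorem SatIn.ultralimit {A : Type u} [L.Structure A] {ι : Type*} (F : Ultrafilter ι)
    {B : ι → Set A} {φ : DFormula L} (hφ : φ.IsUniversal) {T : ι → Team A}
    (h : ∀ᶠ i in F, SatIn (B i) φ (T i)) :
    SatIn {a | ∀ᶠ i in F, a ∈ B i} φ {s | ∀ᶠ i in F, s ∈ T i} := by
  induction φ generalizing T with
  | rel R ts | nrel R ts | eq t₁ t₂ | neq t₁ t₂ =>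
    intro s hs
    obtain ⟨i, hi, hsi⟩ := (h.and hs).exists
    exact hi s hsi
  | dep ys z hd =>
    intro s₁ h₁ s₂ h₂
    obtain ⟨i, hi, h₁, h₂⟩ := (h.and (h₁.and h₂)).exists
    exact hi s₁ h₁ s₂ h₂
  | and φ ψ ih₁ ih₂ =>
    exact ⟨ih₁ hφ.1 (h.mono fun _ h => h.1), ih₂ hφ.2 (h.mono fun _ h => h.2)⟩
  | or φ ψ ih₁ ih₂ =>
    have hex : ∀ i, ∃ U : Team A × Team A, SatIn (B i) (.or φ ψ) (T i) →
        T i ⊆ U.1 ∪ U.2 ∧ SatIn (B i) φ U.1 ∧ SatIn (B i) ψ U.2 := fun i => by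
      by_cases hi : SatIn (B i) (.or φ ψ) (T i)
      · obtain ⟨U₁, U₂, hU⟩ := hi
        exact ⟨(U₁, U₂), fun _ => hU⟩
      · exact ⟨(∅, ∅), fun h => (hi h).elim⟩
    choose U hU using hex
    refine ⟨_, _, ?_, ih₁ hφ.1 (T := fun i => (U i).1) (h.mono fun i hi => (hU i hi).2.1),
      ih₂ hφ.2 (T := fun i => (U i).2) (h.mono fun i hi => (hU i hi).2.2)⟩
    intro s hs
    exact Ultrafilter.eventually_or.1 ((h.and hs).mono fun i hi => (hU i hi.1).1 hi.2)
  | all x φ ih =>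
    refine SatIn.mono (φ := φ) subset_rfl hφ ?_ (ih hφ h)
    rintro _ ⟨s, hs, a, ha, rfl⟩
    filter_upwards [hs, ha] with i hs ha
    exact ⟨s, hs, a, ha, rfl⟩
  | ex x φ ih => exact hφ.elim

/-- The compactness principle behind the theorem: a universal formula that fails in a team of
assignments with finite domain already fails in a finite part of the structure, which can be
chosen to contain any given finite set. -/
theorem exists_finset_not_satIn {A : Type u} [L.Structure A] {φ : DFormula L}
    (hφ : φ.IsUniversal) {V : Finset Var} {T : Team A} (hV : HasDomain T V) (h : ¬ Sat φ T)
    (B₀ : Finset A) :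
    ∃ B : Finset A, B₀ ⊆ B ∧
      ¬ SatIn (B : Set A) φ {s ∈ T | ∀ x, ∀ a ∈ s x, a ∈ B} := by
  classical
  by_contra! hc
  -- Along an ultrafilter refining the order of `Finset A`, the universes tend to the whole of `A`
  -- and the restricted teams to the whole of `T`.
  let F : Ultrafilter (Finset A) := Ultrafilter.of Filter.atTop
  have hF : (F : Filter (Finset A)) ≤ Filter.atTop := Ultrafilter.of_le _
  have hlim := SatIn.ultralimit F (B := fun B => (B : Set A)) hφ
    (hF ((Filter.eventually_ge_atTop B₀).mono hc))
  refine h ((satIn_univ hφ).1 (hlim.mono ?_ hφ ?_))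
  · intro a _
    exact hF ((Filter.eventually_ge_atTop {a}).mono fun B hB => hB (Finset.mem_singleton_self a))
  · intro s hs
    refine hF ((Filter.eventually_ge_atTop (V.biUnion fun x => (s x).toFinset)).mono
      fun B hB => ⟨hs, fun x a ha => hB ?_⟩)
    refine Finset.mem_biUnion.2 ⟨x, ?_, by simpa using ha⟩
    exact Finset.mem_coe.1 ((hV s hs x).1 (Option.isSome_of_mem ha))

/-! ### Correctness of the evaluation -/

/-- The constant symbols in a term, as a list with at most one entry. -/
def termConsts : Term L → List L.Constants
  | Sum.inl _ => []
  | Sum.inr c => [c]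

/-- The constant symbols that occur in a formula. -/
def DFormula.consts : DFormula L → List L.Constants
  | .rel _ ts => (List.ofFn ts).flatMap termConsts
  | .nrel _ ts => (List.ofFn ts).flatMap termConsts
  | .eq t₁ t₂ => termConsts t₁ ++ termConsts t₂
  | .neq t₁ t₂ => termConsts t₁ ++ termConsts t₂
  | .dep _ _ _ => []
  | .and φ ψ => φ.consts ++ ψ.consts
  | .or φ ψ => φ.consts ++ ψ.consts
  | .all _ φ => φ.consts
  | .ex _ φ => φ.consts

/-- The relation symbols that occur in a formula. -/
def DFormula.rels : DFormula L → List (Σ r, L.Relations r)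
  | .rel R _ => [⟨_, R⟩]
  | .nrel R _ => [⟨_, R⟩]
  | .eq _ _ => []
  | .neq _ _ => []
  | .dep _ _ _ => []
  | .and φ ψ => φ.rels ++ ψ.rels
  | .or φ ψ => φ.rels ++ ψ.rels
  | .all _ φ => φ.rels
  | .ex _ φ => φ.rels

section

variable [Encodable L.Constants] [Encodable (Σ r, L.Relations r)]
  {A : Type u} [L.Structure A]

/-- The model code `M` describes the part `B` of a structure, the numbers `0, …, M.1` naming the
elements of `B` by way of `d`, as far as the listed constant and relation symbols go. -/
structure Describes (M : ModelCode) (d : ℕ → A) (B : Set A) (cs : List L.Constants)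
    (rs : List (Σ r, L.Relations r)) : Prop where
  image : d '' Set.Iic M.1 = B
  injOn : Set.InjOn d (Set.Iic M.1)
  const : ∀ c ∈ cs, (c : A) = d (min (M.2.1.getD (encode c) 0) M.1)
  rel : ∀ R ∈ rs, ∀ v : Fin R.1 → ℕ, (∀ i, v i ≤ M.1) →
    (FirstOrder.Language.Structure.RelMap R.2 (d ∘ v) ↔ (encode R, List.ofFn v) ∈ M.2.2)

/-- The assignment `s` and the list `l` of numbers agree on `V`. -/
def Matches (d : ℕ → A) (V : Finset Var) (s : Assignment A) (l : List ℕ) : Prop :=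
  ∀ x ∈ V, s x = some (d (l.getD x 0))

/-- Up to their values outside `V`, the team `T` and the set `X` of lists are the same team. -/
def TeamMatches (d : ℕ → A) (V : Finset Var) (T : Team A) (X : Set (List ℕ)) : Prop :=
  (∀ s ∈ T, ∃ l ∈ X, Matches d V s l) ∧ ∀ l ∈ X, ∃ s ∈ T, Matches d V s l


theorem TeamMatches.mono {A : Type u} {d : ℕ → A} {V W : Finset Var} (h : W ⊆ V) {T : Team A}
    {X : Set (List ℕ)} (hm : TeamMatches d V T X) : TeamMatches d W T X :=
  ⟨fun s hs => (hm.1 s hs).imp fun _ hl => ⟨hl.1, fun x hx => hl.2 x (h hx)⟩,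
    fun l hl => (hm.2 l hl).imp fun _ hs => ⟨hs.1, fun x hx => hs.2 x (h hx)⟩⟩

theorem Describes.mono {M : ModelCode} {d : ℕ → A} {B : Set A} {cs cs' : List L.Constants}
    {rs rs' : List (Σ r, L.Relations r)} (h : Describes M d B cs rs) (hc : cs' ⊆ cs)
    (hr : rs' ⊆ rs) : Describes M d B cs' rs' :=
  ⟨h.image, h.injOn, fun c h' => h.const c (hc h'), fun R h' => h.rel R (hr h')⟩

theorem codeVal_le {M : ModelCode} {b : ℕ} {l : List ℕ} (hl : l ∈ tuples M.1 b) (t : ℕ) :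
    codeVal M l t ≤ M.1 := by
  rw [codeVal]
  split_ifs
  · rw [List.getD_eq_getElem?_getD]
    rcases h : l[t / 2]? with - | a
    · simp
    · exact (mem_tuples.1 hl).2 a (List.mem_of_getElem? h)
  · exact min_le_right _ _

theorem Describes.termVal_eq {M : ModelCode} {d : ℕ → A} {B : Set A} {cs : List L.Constants}
    {rs : List (Σ r, L.Relations r)} (h : Describes M d B cs rs) {V : Finset Var}
    {s : Assignment A} {l : List ℕ} (hs : Matches d V s l) {t : Term L} (hV : termVars t ⊆ V)
    (hc : termConsts t ⊆ cs) : termVal s t = some (d (codeVal M l (encode t))) := by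
  rcases t with x | c
  · have : codeVal M l (encode (Sum.inl x : Term L)) = l.getD x 0 := by
      simp [codeVal]
    rw [this]
    exact hs x (hV (by simp [termVars]))
  · have : codeVal M l (encode (Sum.inr c : Term L)) = min (M.2.1.getD (encode c) 0) M.1 := by
      have h1 : (2 * encode c + 1) % 2 = 1 := by omega
      have h2 : (2 * encode c + 1) / 2 = encode c := by omega
      simp [codeVal, h1, h2]
    rw [this, ← h.const c (hc (by simp [termConsts]))]
    rfl

theorem encode_list_eq_encode_map {α : Type*} [Encodable α] (l : List α) :
    encode l = encode (l.map encode) := by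
  induction l with
  | nil => rfl
  | cons a l ih => simp [Encodable.encode_list_cons, ih]

theorem listOfCode_encode {α : Type*} [Encodable α] (l : List α) :
    listOfCode (encode l) = l.map encode := by
  rw [encode_list_eq_encode_map, listOfCode, encodek]
  rfl

theorem listOfCode_encode_nat (l : List ℕ) : listOfCode (encode l) = l := by
  rw [listOfCode_encode]
  exact List.map_id l

/-- The computed truth value of an atom is correct. The connective `P` is the identity or the
negation, according to the sign of the literal. -/
theorem Describes.atom_iff {M : ModelCode} {d : ℕ → A} {B : Set A} {cs : List L.Constants}
    {rs : List (Σ r, L.Relations r)} (h : Describes M d B cs rs) {V : Finset Var}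
    {s : Assignment A} {l : List ℕ} {b : ℕ} (hl : l ∈ tuples M.1 b) (hs : Matches d V s l)
    {r : ℕ} {R : L.Relations r} (hR : (⟨r, R⟩ : Σ r, L.Relations r) ∈ rs) {ts : Fin r → Term L}
    (hV : ∀ i, termVars (ts i) ⊆ V) (hc : ∀ i, termConsts (ts i) ⊆ cs)
    (P : Prop → Prop) :
    (∃ v, (∀ i, termVal s (ts i) = some (v i)) ∧
        P (FirstOrder.Language.Structure.RelMap R v)) ↔
      P ((encode (⟨r, R⟩ : Σ r, L.Relations r),
        (listOfCode (encode (List.ofFn ts))).map fun t => codeVal M l t) ∈ M.2.2) := by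
  have hv : ∀ i, termVal s (ts i) = some (d (codeVal M l (encode (ts i)))) := fun i =>
    h.termVal_eq hs (hV i) (hc i)
  have hr := h.rel _ hR (fun i => codeVal M l (encode (ts i))) fun i => codeVal_le hl _
  have hmap : (listOfCode (encode (List.ofFn ts))).map (fun t => codeVal M l t) =
      List.ofFn fun i => codeVal M l (encode (ts i)) := by
    rw [listOfCode_encode, List.map_map, List.map_ofFn]
    rfl
  rw [hmap, ← hr]
  constructor
  · rintro ⟨v, hv', hP⟩
    have : v = d ∘ fun i => codeVal M l (encode (ts i)) :=
      funext fun i => Option.some_injective _ ((hv' i).symm.trans (hv i))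
    rwa [this] at hP
  · exact fun hP => ⟨_, hv, hP⟩

/-- A condition on single assignments is evaluated by the list of all assignments meeting it. -/
theorem forall_iff_exists_filter {d : ℕ → A} {V : Finset Var} {T : Team A} {X : Set (List ℕ)}
    (hm : TeamMatches d V T X) {As : List (List ℕ)} (hX : ∀ l ∈ X, l ∈ As)
    {p : Assignment A → Prop} {q : List ℕ → Prop} [DecidablePred q]
    (hpq : ∀ s, ∀ l ∈ As, Matches d V s l → (p s ↔ q l)) :
    (∀ s ∈ T, p s) ↔ ∃ G ∈ [As.filter fun l => q l], ∀ l ∈ X, l ∈ G := by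
  simp only [List.mem_singleton, exists_eq_left, List.mem_filter, decide_eq_true_eq]
  constructor
  · intro h l hl
    obtain ⟨s, hs, hsl⟩ := hm.2 l hl
    exact ⟨hX l hl, (hpq s l (hX l hl) hsl).1 (h s hs)⟩
  · intro h s hs
    obtain ⟨l, hl, hsl⟩ := hm.1 s hs
    exact (hpq s l (hX l hl) hsl).2 (h l hl).2

theorem getD_covTable (M : ModelCode) (As : List (List ℕ)) {m n : ℕ} (h : m < n) :
    (covTable evalStep (M, As) n).getD m [] = goodTeams M As m := by
  rw [List.getD_eq_getElem?_getD, getElem?_covTable _ _ h]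
  rfl

theorem lt_pair_succ (i m : ℕ) : m < Nat.pair (i + 1) m := by
  have := Nat.add_le_pair (i + 1) m
  omega

theorem goodTeams_and (M : ModelCode) (As : List (List ℕ)) (m n : ℕ) :
    goodTeams M As (Nat.pair 5 (Nat.pair m n)) = (goodTeams M As m).flatMap fun X =>
      (goodTeams M As n).map fun Y => X.filter fun l => l ∈ Y := by
  rw [← getD_covTable M As ((Nat.left_le_pair m n).trans_lt (lt_pair_succ 4 _)),
    ← getD_covTable M As ((Nat.right_le_pair m n).trans_lt (lt_pair_succ 4 _))]
  simp [goodTeams, evalStep]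

theorem goodTeams_or (M : ModelCode) (As : List (List ℕ)) (m n : ℕ) :
    goodTeams M As (Nat.pair 6 (Nat.pair m n)) = (goodTeams M As m).flatMap fun X =>
      (goodTeams M As n).map fun Y => X ++ Y := by
  rw [← getD_covTable M As ((Nat.left_le_pair m n).trans_lt (lt_pair_succ 5 _)),
    ← getD_covTable M As ((Nat.right_le_pair m n).trans_lt (lt_pair_succ 5 _))]
  simp [goodTeams, evalStep]

theorem goodTeams_all (M : ModelCode) (As : List (List ℕ)) (x n : ℕ) :
    goodTeams M As (Nat.pair 7 (Nat.pair x n)) = (goodTeams M As n).map fun X =>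
      As.filter fun l => ∀ a ∈ List.range (M.1 + 1), l.set x a ∈ X := by
  rw [← getD_covTable M As ((Nat.right_le_pair x n).trans_lt (lt_pair_succ 6 _))]
  simp [goodTeams, evalStep]

theorem set_mem_tuples {N b : ℕ} {l : List ℕ} (hl : l ∈ tuples N b) (x : ℕ) {a : ℕ}
    (ha : a ≤ N) : l.set x a ∈ tuples N b := by
  rw [mem_tuples] at hl ⊢
  refine ⟨by simpa using hl.1, fun c hc => ?_⟩
  rcases List.mem_or_eq_of_mem_set hc with h | rfl
  · exact hl.2 c h
  · exact ha

theorem matches_set {d : ℕ → A} {V : Finset Var} {s : Assignment A} {l : List ℕ} {x : Var}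
    (h : Matches d (V.erase x) s l) (hx : x < l.length) (a : ℕ) :
    Matches d V (assign s x (d a)) (l.set x a) := by
  intro y hy
  rw [assign, List.getD_eq_getElem?_getD]
  by_cases hyx : y = x
  · subst hyx
    simp [hx]
  · rw [Function.update_of_ne hyx, List.getElem?_set_ne (Ne.symm hyx),
      ← List.getD_eq_getElem?_getD]
    exact h y (Finset.mem_erase.2 ⟨hyx, hy⟩)

/-- The evaluation is correct: on teams that match, satisfaction in the described part of a
structure coincides with being contained in one of the computed teams. Every bound variable is
below the code of the formula, so that lists of length `b` have a place for it. -/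
theorem satIn_iff_exists_goodTeams {M : ModelCode} {d : ℕ → A} {B : Set A} {b : ℕ}
    {φ : DFormula L} (hφ : φ.IsUniversal) (hb : φ.code < b)
    (hd : Describes M d B φ.consts φ.rels) {T : Team A} {X : Set (List ℕ)}
    (hX : ∀ l ∈ X, l ∈ tuples M.1 b) (hm : TeamMatches d φ.freeVars T X) :
    SatIn B φ T ↔ ∃ G ∈ goodTeams M (tuples M.1 b) φ.code, ∀ l ∈ X, l ∈ G := by
  induction φ generalizing T X with
  | rel R ts =>
    have hg : goodTeams M (tuples M.1 b) (DFormula.rel R ts).code = [(tuples M.1 b).filter fun l =>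
        (encode (⟨_, R⟩ : Σ r, L.Relations r),
          (listOfCode (encode (List.ofFn ts))).map fun t => codeVal M l t) ∈ M.2.2] := by
      simp [goodTeams, evalStep, DFormula.code]
    rw [hg]
    refine forall_iff_exists_filter hm hX fun s l hl hsl =>
      hd.atom_iff hl hsl (by simp [DFormula.rels]) (fun i => ?_) (fun i => ?_) id
    · exact Finset.subset_biUnion_of_mem (fun i => termVars (ts i)) (Finset.mem_univ i)
    · exact fun c hc => List.mem_flatMap.2 ⟨ts i, List.mem_ofFn.2 ⟨i, rfl⟩, hc⟩
  | nrel R ts =>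
    have hg : goodTeams M (tuples M.1 b) (DFormula.nrel R ts).code = [(tuples M.1 b).filter fun l =>
        (encode (⟨_, R⟩ : Σ r, L.Relations r),
          (listOfCode (encode (List.ofFn ts))).map fun t => codeVal M l t) ∉ M.2.2] := by
      simp [goodTeams, evalStep, DFormula.code]
    rw [hg]
    refine forall_iff_exists_filter hm hX fun s l hl hsl =>
      hd.atom_iff hl hsl (by simp [DFormula.rels]) (fun i => ?_) (fun i => ?_) Not
    · exact Finset.subset_biUnion_of_mem (fun i => termVars (ts i)) (Finset.mem_univ i)
    · exact fun c hc => List.mem_flatMap.2 ⟨ts i, List.mem_ofFn.2 ⟨i, rfl⟩, hc⟩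
  | eq t₁ t₂ =>
    have hg : goodTeams M (tuples M.1 b) (DFormula.eq t₁ t₂).code = [(tuples M.1 b).filter fun l =>
        codeVal M l (encode t₁) = codeVal M l (encode t₂)] := by
      simp [goodTeams, evalStep, DFormula.code]
    rw [hg]
    refine forall_iff_exists_filter hm hX fun s l hl hsl => ?_
    rw [hd.termVal_eq hsl (t := t₁) (Finset.subset_union_left) (List.subset_append_left _ _),
      hd.termVal_eq hsl (t := t₂) (Finset.subset_union_right) (List.subset_append_right _ _),
      Option.some_inj]
    exact hd.injOn.eq_iff (codeVal_le hl _) (codeVal_le hl _)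
  | neq t₁ t₂ =>
    have hg : goodTeams M (tuples M.1 b) (DFormula.neq t₁ t₂).code = [(tuples M.1 b).filter fun l =>
        codeVal M l (encode t₁) ≠ codeVal M l (encode t₂)] := by
      simp [goodTeams, evalStep, DFormula.code]
    rw [hg]
    refine forall_iff_exists_filter hm hX fun s l hl hsl => ?_
    rw [hd.termVal_eq hsl (t := t₁) (Finset.subset_union_left) (List.subset_append_left _ _),
      hd.termVal_eq hsl (t := t₂) (Finset.subset_union_right) (List.subset_append_right _ _),
      ne_eq, Option.some_inj]
    exact not_congr (hd.injOn.eq_iff (codeVal_le hl _) (codeVal_le hl _))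
  | dep ys z hdist =>
    have hg : goodTeams M (tuples M.1 b) (DFormula.dep (L := L) ys z hdist).code =
        (tuples M.1 b).sublists'.filter fun X => ∀ l ∈ X, ∀ l' ∈ X,
          (∀ y ∈ ys, l.getD y 0 = l'.getD y 0) → l.getD z 0 = l'.getD z 0 := by
      simp [goodTeams, evalStep, DFormula.code, listOfCode_encode_nat]
    have hval {s s' : Assignment A} {l l' : List ℕ}
        (hs : Matches d (z :: ys).toFinset s l) (hs' : Matches d (z :: ys).toFinset s' l')
        (hl : l ∈ tuples M.1 b) (hl' : l' ∈ tuples M.1 b) {y : Var} (hy : y ∈ z :: ys) :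
        s y = s' y ↔ l.getD y 0 = l'.getD y 0 := by
      have hle {l : List ℕ} (hl : l ∈ tuples M.1 b) : l.getD y 0 ∈ Set.Iic M.1 := by
        simpa [codeVal] using codeVal_le hl (2 * y)
      rw [hs y (List.mem_toFinset.2 hy), hs' y (List.mem_toFinset.2 hy), Option.some_inj]
      exact hd.injOn.eq_iff (hle hl) (hle hl')
    rw [hg]
    constructor
    · intro h
      classical
      refine ⟨(tuples M.1 b).filter fun l => l ∈ X, ?_, fun l hl => by simp [hX l hl, hl]⟩
      simp only [List.mem_filter, List.mem_sublists', List.filter_sublist, decide_eq_true_eq,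
        true_and]
      rintro l ⟨hl, hlX⟩ l' ⟨hl', hlX'⟩ hy
      obtain ⟨s, hs, hsl⟩ := hm.2 l hlX
      obtain ⟨s', hs', hsl'⟩ := hm.2 l' hlX'
      refine (hval hsl hsl' hl hl' List.mem_cons_self).1 (h s hs s' hs' fun y hy' => ?_)
      exact (hval hsl hsl' hl hl' (List.mem_cons_of_mem z hy')).2 (hy y hy')
    · rintro ⟨G, hG, hXG⟩ s hs s' hs' hy
      obtain ⟨l, hl, hsl⟩ := hm.1 s hs
      obtain ⟨l', hl', hsl'⟩ := hm.1 s' hs'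
      rw [hval hsl hsl' (hX l hl) (hX l' hl') List.mem_cons_self]
      refine (by simpa using (List.mem_filter.1 hG).2 : ∀ l ∈ G, ∀ l' ∈ G,
        (∀ y ∈ ys, l.getD y 0 = l'.getD y 0) → l.getD z 0 = l'.getD z 0) l (hXG l hl) l'
          (hXG l' hl') fun y hy' => ?_
      exact (hval hsl hsl' (hX l hl) (hX l' hl') (List.mem_cons_of_mem z hy')).1 (hy y hy')
  | and φ ψ ih₁ ih₂ =>
    have h₁ := (Nat.left_le_pair φ.code ψ.code).trans_lt (lt_pair_succ 4 _)
    have h₂ := (Nat.right_le_pair φ.code ψ.code).trans_lt (lt_pair_succ 4 _)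
    rw [SatIn, ih₁ hφ.1 (h₁.trans hb) (hd.mono (List.subset_append_left _ _)
        (List.subset_append_left _ _)) hX (hm.mono Finset.subset_union_left),
      ih₂ hφ.2 (h₂.trans hb) (hd.mono (List.subset_append_right _ _)
        (List.subset_append_right _ _)) hX (hm.mono Finset.subset_union_right),
      DFormula.code, goodTeams_and]
    constructor
    · rintro ⟨⟨G, hG, hXG⟩, G', hG', hXG'⟩
      refine ⟨_, List.mem_flatMap.2 ⟨G, hG, List.mem_map.2 ⟨G', hG', rfl⟩⟩, fun l hl => ?_⟩
      simp [hXG l hl, hXG' l hl]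
    · rintro ⟨G, hG, hXG⟩
      obtain ⟨G₁, hG₁, hG⟩ := List.mem_flatMap.1 hG
      obtain ⟨G₂, hG₂, rfl⟩ := List.mem_map.1 hG
      simp only [List.mem_filter, decide_eq_true_eq] at hXG
      exact ⟨⟨G₁, hG₁, fun l hl => (hXG l hl).1⟩, G₂, hG₂, fun l hl => (hXG l hl).2⟩
  | or φ ψ ih₁ ih₂ =>
    have h₁ := (Nat.left_le_pair φ.code ψ.code).trans_lt (lt_pair_succ 5 _)
    have h₂ := (Nat.right_le_pair φ.code ψ.code).trans_lt (lt_pair_succ 5 _)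
    have hd₁ := hd.mono (List.subset_append_left φ.consts ψ.consts)
      (List.subset_append_left φ.rels ψ.rels)
    have hd₂ := hd.mono (List.subset_append_right φ.consts ψ.consts)
      (List.subset_append_right φ.rels ψ.rels)
    have hV₁ : φ.freeVars ⊆ (φ.or ψ).freeVars := Finset.subset_union_left
    have hV₂ : ψ.freeVars ⊆ (φ.or ψ).freeVars := Finset.subset_union_right
    rw [DFormula.code, goodTeams_or]
    constructor
    · rintro ⟨T₁, T₂, hU, hs₁, hs₂⟩
      -- `Y T'` is the part of `X` that matches assignments in `T'`.
      let Y (T' : Team A) : Set (List ℕ) :=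
        {l ∈ X | ∃ s ∈ T ∩ T', Matches d (φ.or ψ).freeVars s l}
      have hY (T' : Team A) : TeamMatches d (φ.or ψ).freeVars (T ∩ T') (Y T') := by
        refine ⟨fun s hs => ?_, fun l hl => hl.2⟩
        obtain ⟨l, hl, hsl⟩ := hm.1 s hs.1
        exact ⟨l, ⟨hl, s, hs, hsl⟩, hsl⟩
      obtain ⟨G, hG, hXG⟩ := (ih₁ hφ.1 (h₁.trans hb) hd₁ (fun l hl => hX l hl.1)
        ((hY T₁).mono hV₁)).1 (hs₁.mono subset_rfl hφ.1 Set.inter_subset_right)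
      obtain ⟨G', hG', hXG'⟩ := (ih₂ hφ.2 (h₂.trans hb) hd₂ (fun l hl => hX l hl.1)
        ((hY T₂).mono hV₂)).1 (hs₂.mono subset_rfl hφ.2 Set.inter_subset_right)
      refine ⟨_, List.mem_flatMap.2 ⟨G, hG, List.mem_map.2 ⟨G', hG', rfl⟩⟩, fun l hl => ?_⟩
      obtain ⟨s, hs, hsl⟩ := hm.2 l hl
      rw [List.mem_append]
      exact (hU hs).imp (fun h => hXG l ⟨hl, s, ⟨hs, h⟩, hsl⟩)
        fun h => hXG' l ⟨hl, s, ⟨hs, h⟩, hsl⟩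
    · rintro ⟨G, hG, hXG⟩
      obtain ⟨G₁, hG₁, hG⟩ := List.mem_flatMap.1 hG
      obtain ⟨G₂, hG₂, rfl⟩ := List.mem_map.1 hG
      -- `U G` is the part of `T` that matches lists in `G`.
      let U (G : List (List ℕ)) : Team A :=
        {s ∈ T | ∃ l ∈ X, l ∈ G ∧ Matches d (φ.or ψ).freeVars s l}
      have hU (G : List (List ℕ)) :
          TeamMatches d (φ.or ψ).freeVars (U G) {l ∈ X | l ∈ G} := by
        refine ⟨fun s hs => ?_, fun l hl => ?_⟩
        · obtain ⟨-, l, hl, hlG, hsl⟩ := hs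
          exact ⟨l, ⟨hl, hlG⟩, hsl⟩
        · obtain ⟨s, hs, hsl⟩ := hm.2 l hl.1
          exact ⟨s, ⟨hs, l, hl.1, hl.2, hsl⟩, hsl⟩
      refine ⟨U G₁, U G₂, fun s hs => ?_,
        (ih₁ hφ.1 (h₁.trans hb) hd₁ (fun l hl => hX l hl.1) ((hU G₁).mono hV₁)).2
          ⟨G₁, hG₁, fun l hl => hl.2⟩,
        (ih₂ hφ.2 (h₂.trans hb) hd₂ (fun l hl => hX l hl.1) ((hU G₂).mono hV₂)).2
          ⟨G₂, hG₂, fun l hl => hl.2⟩⟩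
      obtain ⟨l, hl, hsl⟩ := hm.1 s hs
      exact (List.mem_append.1 (hXG l hl)).imp (fun h => ⟨hs, l, hl, h, hsl⟩)
        fun h => ⟨hs, l, hl, h, hsl⟩
  | all x φ ih =>
    have h₁ : φ.code < b :=
      ((Nat.right_le_pair x φ.code).trans_lt (lt_pair_succ 6 _)).trans hb
    have hx : x < b := ((Nat.left_le_pair x φ.code).trans_lt (lt_pair_succ 6 _)).trans hb
    have hlen {l : List ℕ} (hl : l ∈ X) : x < l.length := by
      rwa [(mem_tuples.1 (hX l hl)).1]
    have hm' : TeamMatches d φ.freeVars {s' | ∃ s ∈ T, ∃ a ∈ B, s' = assign s x a}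
        {l' | ∃ l ∈ X, ∃ a ≤ M.1, l' = l.set x a} := by
      constructor
      · rintro _ ⟨s, hs, a, ha, rfl⟩
        rw [← hd.image] at ha
        obtain ⟨n, hn, rfl⟩ := ha
        obtain ⟨l, hl, hsl⟩ := hm.1 s hs
        exact ⟨_, ⟨l, hl, n, hn, rfl⟩, matches_set hsl (hlen hl) n⟩
      · rintro _ ⟨l, hl, n, hn, rfl⟩
        obtain ⟨s, hs, hsl⟩ := hm.2 l hl
        exact ⟨_, ⟨s, hs, d n, hd.image ▸ Set.mem_image_of_mem d hn, rfl⟩,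
          matches_set hsl (hlen hl) n⟩
    rw [SatIn, ih hφ h₁ hd ?_ hm', DFormula.code, goodTeams_all]
    · simp only [List.mem_map, exists_exists_and_eq_and, List.mem_filter, List.mem_range,
        decide_eq_true_eq]
      refine exists_congr fun G => and_congr_right fun hG => ⟨fun h l hl => ?_, ?_⟩
      · exact ⟨hX l hl, fun n hn => h _ ⟨l, hl, n, Nat.lt_succ_iff.1 hn, rfl⟩⟩
      · rintro h _ ⟨l, hl, n, hn, rfl⟩
        exact (h l hl).2 n (Nat.lt_succ_iff.2 hn)
    · rintro _ ⟨l, hl, n, hn, rfl⟩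
      exact set_mem_tuples (hX l hl) x hn
  | ex x φ ih => exact hφ.elim

end

/-! ### Decidability of being the code of a universal formula -/

section

/-- Whether `q` is the code of a relation symbol together with a list of terms whose length is its
arity. Decoding is followed by encoding, because decoding may succeed on numbers that are not
codes. -/
def isAtomCode (L : FirstOrder.Language.{0, 0}) [Primcodable L.Constants]
    [Primcodable (Σ r, L.Relations r)] (q : ℕ) : Bool :=
  ((decode q : Option ((Σ r, L.Relations r) × List (Term L))).map fun x =>
    decide (encode x = q) && decide (x.1.1 = x.2.length)).getD false

/-- The condition for the number `Nat.pair i q` with `2 ≤ i` to be the code of a universal formula;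
`prev` lists for each smaller number whether it is such a code. -/
def IsNonAtomCode (L : FirstOrder.Language.{0, 0}) [Primcodable L.Constants] (i q : ℕ)
    (prev : List Bool) : Prop :=
  ((i = 2 ∨ i = 3) ∧ encode (decode q : Option (Term L × Term L)) = q + 1) ∨
  (i = 4 ∧ encode (decode q : Option (List ℕ × ℕ)) = q + 1 ∧
    ∀ a ∈ q.unpair.2 :: listOfCode q.unpair.1,
      [a, a] ∉ (q.unpair.2 :: listOfCode q.unpair.1).sublists') ∨
  ((i = 5 ∨ i = 6) ∧ prev.getD q.unpair.1 false = true ∧ prev.getD q.unpair.2 false = true) ∨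
  (i = 7 ∧ prev.getD q.unpair.2 false = true)

open Classical in
/-- One step of the decision whether a number is the code of a universal formula. -/
noncomputable def wfStep (L : FirstOrder.Language.{0, 0}) [Primcodable L.Constants]
    [Primcodable (Σ r, L.Relations r)] (_ : Unit) (prev : List Bool) : Bool :=
  bif decide (prev.length.unpair.1 < 2) then isAtomCode L prev.length.unpair.2
  else decide (IsNonAtomCode L prev.length.unpair.1 prev.length.unpair.2 prev)

/-- Whether `n` is the code of a universal formula. -/
noncomputable def isUniversalCode (L : FirstOrder.Language.{0, 0}) [Primcodable L.Constants]
    [Primcodable (Σ r, L.Relations r)] (n : ℕ) : Bool :=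
  wfStep L () (covTable (wfStep L) () n)

theorem primrecPred_isNonAtomCode [Primcodable L.Constants] : PrimrecPred fun prev : List Bool =>
    IsNonAtomCode L prev.length.unpair.1 prev.length.unpair.2 prev := by
  have hn : Primrec fun prev : List Bool => prev.length.unpair :=
    Primrec.unpair.comp Primrec.list_length
  have hq0 : Primrec fun prev : List Bool => prev.length.unpair.2 := Primrec.snd.comp hn
  have hq : Primrec fun prev : List Bool => prev.length.unpair.2.unpair :=
    Primrec.unpair.comp hq0
  have hq1 := Primrec.fst.comp hq
  have hq2 := Primrec.snd.comp hq
  have tag (i : ℕ) : PrimrecPred fun prev : List Bool => prev.length.unpair.1 = i :=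
    Primrec.eq.comp (Primrec.fst.comp hn) (Primrec.const i)
  have isCode (α : Type) [Primcodable α] : PrimrecPred fun prev : List Bool =>
      encode (decode prev.length.unpair.2 : Option α) = prev.length.unpair.2 + 1 :=
    Primrec.eq.comp (Primrec.encode.comp (Primrec.decode.comp hq0)) (Primrec.succ.comp hq0)
  have lookup {f : List Bool → ℕ} (hf : Primrec f) :
      PrimrecPred fun prev : List Bool => prev.getD (f prev) false = true :=
    Primrec.eq.comp ((Primrec.list_getD false).comp Primrec.id hf) (Primrec.const true)
  have hl : Primrec fun prev : List Bool =>
      prev.length.unpair.2.unpair.2 :: listOfCode prev.length.unpair.2.unpair.1 :=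
    Primrec.list_cons.comp hq2 (primrec_listOfCode.comp hq1)
  refine (((tag 2).or (tag 3)).and (isCode _)).or <|
    ((tag 4).and ((isCode (List ℕ × ℕ)).and ?_)).or <|
    (((tag 5).or (tag 6)).and ((lookup hq1).and (lookup hq2))).or <|
    (tag 7).and (lookup hq2)
  refine primrecPred_ball hl (PrimrecPred.not (primrecPred_mem ?_ ?_))
  · exact Primrec.list_cons.comp Primrec.snd
      (Primrec.list_cons.comp Primrec.snd (Primrec.const []))
  · exact primrec_sublists'.comp (hl.comp Primrec.fst)

variable [Primcodable L.Constants] [Primcodable (Σ r, L.Relations r)]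

theorem computable_isAtomCode (harity : Computable fun R : (Σ r, L.Relations r) => R.1) :
    Computable (isAtomCode L) := by
  refine Computable.option_getD (Computable.option_map Computable.decode ?_) (Computable.const _)
  have h₁ : Computable fun x : ℕ × ((Σ r, L.Relations r) × List (Term L)) =>
      decide (encode x.2 = x.1) :=
    (Primrec.eq.decide.comp (Primrec.encode.comp Primrec.snd) Primrec.fst).to_comp
  have h₂ : Computable fun x : ℕ × ((Σ r, L.Relations r) × List (Term L)) =>
      decide (x.2.1.1 = x.2.2.length) :=
    Primrec.eq.decide.to_comp.comp
      (harity.comp (Computable.fst.comp Computable.snd))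
      (Computable.list_length.comp (Computable.snd.comp Computable.snd))
  exact Primrec.and.to_comp.comp h₁ h₂

theorem computable_isUniversalCode
    (harity : Computable fun R : (Σ r, L.Relations r) => R.1) :
    Computable (isUniversalCode L) := by
  classical
  have hn : Primrec fun x : Unit × List Bool => x.2.length.unpair :=
    Primrec.unpair.comp (Primrec.list_length.comp Primrec.snd)
  have hstep : Computable₂ (wfStep L) := by
    refine Computable.cond
      (Primrec.nat_lt.decide.comp (Primrec.fst.comp hn) (Primrec.const 2)).to_comp
      ((computable_isAtomCode harity).comp (Primrec.snd.comp hn).to_comp) ?_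
    exact (PrimrecPred.decide (primrecPred_isNonAtomCode.comp Primrec.snd)).to_comp
  exact hstep.comp (Computable.const ())
    ((computable_covTable hstep).comp (Computable.const ()) Computable.id)

theorem isAtomCode_iff {q : ℕ} : isAtomCode L q = true ↔
    ∃ (r : ℕ) (R : L.Relations r) (ts : Fin r → Term L),
      q = encode ((⟨r, R⟩ : Σ r, L.Relations r), List.ofFn ts) := by
  rw [isAtomCode]
  constructor
  · intro h
    rcases hq : (decode q : Option ((Σ r, L.Relations r) × List (Term L))) with - | ⟨⟨r, R⟩, ts⟩
    · simp [hq] at h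
    · simp only [hq, Option.map_some, Option.getD_some, Bool.and_eq_true,
        decide_eq_true_eq] at h
      obtain ⟨h, rfl⟩ := h
      exact ⟨_, R, ts.get, by rw [List.ofFn_get, h]⟩
  · rintro ⟨r, R, ts, rfl⟩
    rw [encodek]
    simp

theorem encode_decode_eq_succ {α : Type*} [Encodable α] {q : ℕ} :
    encode (decode q : Option α) = q + 1 ↔ ∃ a : α, q = encode a := by
  constructor
  · intro h
    rcases hq : (decode q : Option α) with - | a
    · simp [hq] at h
    · exact ⟨a, by simpa [hq] using h.symm⟩
  · rintro ⟨a, rfl⟩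
    simp

theorem nodup_iff_forall_pair_notMem_sublists' {α : Type*} {l : List α} :
    (∀ a ∈ l, [a, a] ∉ l.sublists') ↔ l.Nodup := by
  rw [List.nodup_iff_sublist]
  simp only [List.mem_sublists']
  exact ⟨fun h a ha => h a (ha.subset List.mem_cons_self) ha, fun h a _ => h a⟩

theorem getD_covTable_wfStep {m n : ℕ} (h : m < n) :
    (covTable (wfStep L) () n).getD m false = isUniversalCode L m := by
  rw [List.getD_eq_getElem?_getD, getElem?_covTable _ _ h]
  rfl

theorem isUniversalCode_iff {n : ℕ} :
    isUniversalCode L n = true ↔ ∃ φ : DFormula L, φ.IsUniversal ∧ φ.code = n := by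
  classical
  induction n using Nat.strong_induction_on with
  | _ n ih =>
  have hpair : n = Nat.pair n.unpair.1 n.unpair.2 := (Nat.pair_unpair n).symm
  rw [isUniversalCode, wfStep, length_covTable]
  generalize n.unpair.1 = i at hpair ⊢
  generalize n.unpair.2 = q at hpair ⊢
  have hq : 2 ≤ i → q < n := fun hi => by
    have := Nat.add_le_pair i q
    omega
  have hleft (hi : 2 ≤ i) : q.unpair.1 < n := (Nat.unpair_left_le q).trans_lt (hq hi)
  have hright (hi : 2 ≤ i) : q.unpair.2 < n := (Nat.unpair_right_le q).trans_lt (hq hi)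
  by_cases hi : i < 2
  · simp only [hi, decide_true, cond_true]
    rw [isAtomCode_iff]
    constructor
    · rintro ⟨r, R, ts, rfl⟩
      obtain rfl | rfl : i = 0 ∨ i = 1 := by omega
      · exact ⟨.rel R ts, trivial, hpair.symm⟩
      · exact ⟨.nrel R ts, trivial, hpair.symm⟩
    · rintro ⟨φ, -, hφ⟩
      rw [hpair] at hφ
      cases φ <;> simp only [DFormula.code, Nat.pair_eq_pair] at hφ <;> try omega
      · exact ⟨_, _, _, hφ.2.symm⟩
      · exact ⟨_, _, _, hφ.2.symm⟩
  · have hi' : 2 ≤ i := not_lt.1 hi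
    simp only [hi, decide_false, cond_false, decide_eq_true_eq]
    rw [IsNonAtomCode, getD_covTable_wfStep (hleft hi'), getD_covTable_wfStep (hright hi'),
      ih _ (hleft hi'), ih _ (hright hi'), encode_decode_eq_succ, encode_decode_eq_succ,
      nodup_iff_forall_pair_notMem_sublists']
    constructor
    · rintro (⟨h, ⟨t₁, t₂⟩, rfl⟩ | ⟨rfl, ⟨⟨ys, z⟩, rfl⟩, h⟩ |
        ⟨h, ⟨φ, hφ, h₁⟩, ψ, hψ, h₂⟩ | ⟨rfl, φ, hφ, h₁⟩)
      · rcases h with rfl | rfl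
        · exact ⟨.eq t₁ t₂, trivial, hpair.symm⟩
        · exact ⟨.neq t₁ t₂, trivial, hpair.symm⟩
      · rw [encode_prod_val, Nat.unpair_pair, listOfCode_encode_nat] at h
        refine ⟨.dep ys z ?_, trivial, hpair.symm⟩
        simpa using h
      · have hc : n = Nat.pair i (Nat.pair φ.code ψ.code) := by
          rw [hpair, h₁, h₂, Nat.pair_unpair]
        rcases h with rfl | rfl
        · exact ⟨.and φ ψ, ⟨hφ, hψ⟩, hc.symm⟩
        · exact ⟨.or φ ψ, ⟨hφ, hψ⟩, hc.symm⟩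
      · refine ⟨.all q.unpair.1 φ, hφ, ?_⟩
        rw [DFormula.code, hpair, h₁, Nat.pair_unpair]
    · rintro ⟨φ, hu, hφ⟩
      rw [hpair] at hφ
      cases φ <;> simp only [DFormula.code, Nat.pair_eq_pair] at hφ <;> obtain ⟨rfl, rfl⟩ := hφ
      · omega
      · omega
      · exact Or.inl ⟨Or.inl rfl, _, rfl⟩
      · exact Or.inl ⟨Or.inr rfl, _, rfl⟩
      · rename_i ys z hd
        refine Or.inr (Or.inl ⟨rfl, ⟨_, rfl⟩, ?_⟩)
        rw [encode_prod_val, Nat.unpair_pair, listOfCode_encode_nat]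
        simpa using hd
      · rw [Nat.unpair_pair]
        exact Or.inr (Or.inr (Or.inl ⟨Or.inl rfl, ⟨_, hu.1, rfl⟩, _, hu.2, rfl⟩))
      · rw [Nat.unpair_pair]
        exact Or.inr (Or.inr (Or.inl ⟨Or.inr rfl, ⟨_, hu.1, rfl⟩, _, hu.2, rfl⟩))
      · rename_i x φ
        rw [Nat.unpair_pair]
        exact Or.inr (Or.inr (Or.inr ⟨rfl, φ, hu, rfl⟩))
      · exact hu.elim

end

/-! ### Coherence and finite counterexamples -/

/-- Coherence with respect to the subteams whose number of elements is finite and in the relation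
`ρ` to `k`; the relations `=` and `≤` give the two readings of `k`-coherence. -/
def KCoherentFor (ρ : ℕ → ℕ → Prop) (φ : DFormula L) (k : ℕ) : Prop :=
  ∀ (A : Type u) [Nonempty A] [L.Structure A] (T : Team A), HasDomain T φ.freeVars →
    (Sat φ T ↔ ∀ S ⊆ T, S.Finite → ρ S.ncard k → Sat φ S)

theorem kCoherent_iff {φ : DFormula L} {k : ℕ} :
    KCoherent.{u} φ k ↔ KCoherentFor.{u} (· = ·) φ k := by
  have h {A : Type u} (S : Team A) : S.encard = k ↔ S.Finite ∧ S.ncard = k := by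
    constructor
    · intro h
      exact ⟨Set.finite_of_encard_eq_coe h, by rw [Set.ncard, h]; rfl⟩
    · rintro ⟨hf, rfl⟩
      exact hf.cast_ncard_eq.symm
  simp only [KCoherent, KCoherentFor, h, and_imp]

theorem kCoherentAtMost_iff {φ : DFormula L} {k : ℕ} :
    KCoherentAtMost.{u} φ k ↔ KCoherentFor.{u} (· ≤ ·) φ k := by
  have h {A : Type u} (S : Team A) : S.encard ≤ k ↔ S.Finite ∧ S.ncard ≤ k := by
    constructor
    · intro h
      have hf := Set.finite_of_encard_le_coe h
      rw [← hf.cast_ncard_eq] at h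
      exact ⟨hf, by exact_mod_cast h⟩
    · rintro ⟨hf, h⟩
      rw [← hf.cast_ncard_eq]
      exact_mod_cast h
  simp only [KCoherentAtMost, KCoherentFor, h, and_imp]

/-- The triple `w` of a model code, a bound `b` for the variables, and a list of assignments
codes a counterexample to the coherence of the formula `φ`, where `n = Nat.pair φ.code k`: the team
fails `φ`, while its subteams with the relevant numbers of elements satisfy `φ`. -/
def IsCounterexample (ρ : ℕ → ℕ → Prop) (n : ℕ) (w : ModelCode × ℕ × List (List ℕ)) : Prop :=
  n.unpair.1 < w.2.1 ∧ w.2.2 ⊆ tuples w.1.1 w.2.1 ∧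
    (∀ S ∈ w.2.2.sublists', ρ S.length n.unpair.2 →
      ∃ G ∈ goodTeams w.1 (tuples w.1.1 w.2.1) n.unpair.1, S ⊆ G) ∧
    ¬ ∃ G ∈ goodTeams w.1 (tuples w.1.1 w.2.1) n.unpair.1, w.2.2 ⊆ G

theorem primrecPred_isCounterexample {α : Type*} [Primcodable α] {ρ : ℕ → ℕ → Prop}
    (hρ : PrimrecRel ρ) {n : α → ℕ} {M : α → ModelCode} {b : α → ℕ} {T : α → List (List ℕ)}
    (hn : Primrec n) (hM : Primrec M) (hb : Primrec b) (hT : Primrec T) :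
    PrimrecPred fun a => IsCounterexample ρ (n a) (M a, b a, T a) := by
  have hn₁ : Primrec fun a => (n a).unpair.1 := Primrec.fst.comp (Primrec.unpair.comp hn)
  have hn₂ : Primrec fun a => (n a).unpair.2 := Primrec.snd.comp (Primrec.unpair.comp hn)
  have hAs : Primrec fun a => tuples (M a).1 (b a) :=
    primrec_tuples.comp (Primrec.fst.comp hM) hb
  have hG : Primrec fun a => goodTeams (M a) (tuples (M a).1 (b a)) (n a).unpair.1 :=
    primrec_goodTeams hM hAs hn₁
  have hS : PrimrecPred fun a => ∀ S ∈ (T a).sublists', ρ S.length (n a).unpair.2 →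
      ∃ G ∈ goodTeams (M a) (tuples (M a).1 (b a)) (n a).unpair.1, S ⊆ G :=
    primrecPred_ball (primrec_sublists'.comp hT) <| primrecPred_imp
      (hρ.comp (Primrec.list_length.comp Primrec.snd) (hn₂.comp Primrec.fst))
      (primrecPred_bex (hG.comp Primrec.fst)
        (primrecPred_subset (Primrec.snd.comp Primrec.fst) Primrec.snd))
  have hT' : PrimrecPred fun a =>
      ∃ G ∈ goodTeams (M a) (tuples (M a).1 (b a)) (n a).unpair.1, T a ⊆ G :=
    primrecPred_bex hG (primrecPred_subset (hT.comp Primrec.fst) Primrec.snd)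
  exact (Primrec.nat_lt.comp hn₁ hb).and ((primrecPred_subset hT hAs).and (hS.and hT'.not))

/-- The structure on `{0, …, M.1}` coded by `M`. -/
@[reducible] def codedStructure [∀ n, IsEmpty (L.Functions (n + 1))] [Encodable L.Constants]
    [Encodable (Σ r, L.Relations r)] (M : ModelCode) :
    L.Structure (ULift.{u} (Fin (M.1 + 1))) where
  funMap {n} f _ :=
    match n, f with
    | 0, c => ⟨Fin.ofNat (M.1 + 1) (min (M.2.1.getD (encode (α := L.Constants) c) 0) M.1)⟩
    | _ + 1, f => isEmptyElim f
  RelMap {r} R v :=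
    (encode (⟨r, R⟩ : Σ r, L.Relations r), List.ofFn fun i => (v i).down.val) ∈ M.2.2

theorem describes_codedStructure [∀ n, IsEmpty (L.Functions (n + 1))] [Encodable L.Constants]
    [Encodable (Σ r, L.Relations r)] (M : ModelCode) (cs : List L.Constants)
    (rs : List (Σ r, L.Relations r)) :
    letI : L.Structure (ULift.{u} (Fin (M.1 + 1))) := codedStructure M
    Describes M (fun n => (⟨Fin.ofNat (M.1 + 1) n⟩ : ULift.{u} (Fin (M.1 + 1)))) Set.univ cs rs := by
  let _ : L.Structure (ULift.{u} (Fin (M.1 + 1))) := codedStructure M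
  have hval {n : ℕ} (hn : n ≤ M.1) : (Fin.ofNat (M.1 + 1) n).val = n :=
    Nat.mod_eq_of_lt (Nat.lt_succ_iff.2 hn)
  refine ⟨Set.eq_univ_of_forall fun ⟨i⟩ => ⟨i.val, Nat.lt_succ_iff.1 i.isLt, ?_⟩, ?_, ?_, ?_⟩
  · exact congrArg ULift.up (Fin.ext (hval (Nat.lt_succ_iff.1 i.isLt)))
  · intro m hm n hn h
    rw [← hval hm, ← hval hn]
    exact congrArg (fun i => i.down.val) h
  · exact fun c _ => rfl
  · intro R _ v hv
    have : (List.ofFn fun i => (Fin.ofNat (M.1 + 1) (v i)).val) = List.ofFn v :=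
      congrArg List.ofFn (funext fun i => hval (hv i))
    rw [← this]
    rfl

/-- The partial assignment with domain `V` described by a list of numbers. -/
def toAssignment {A : Type u} (d : ℕ → A) (V : Finset Var) (l : List ℕ) : Assignment A :=
  fun x => if x ∈ V then some (d (l.getD x 0)) else none

theorem teamMatches_image {A : Type u} (d : ℕ → A) (V : Finset Var) (X : Set (List ℕ)) :
    TeamMatches d V (toAssignment d V '' X) X := by
  have h (l : List ℕ) : Matches d V (toAssignment d V l) l := fun x hx => if_pos hx
  exact ⟨by rintro _ ⟨l, hl, rfl⟩; exact ⟨l, hl, h l⟩, fun l hl => ⟨_, ⟨l, hl, rfl⟩, h l⟩⟩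

/-- Every subset of a list is enumerated without repetitions by a sublist, even if the list has
repetitions. -/
theorem exists_sublist_of_subset {α : Type*} {T : List α} {X : Set α} (h : ∀ a ∈ X, a ∈ T) :
    ∃ S : List α, S.Sublist T ∧ S.length = X.ncard ∧ ∀ a, a ∈ S ↔ a ∈ X := by
  classical
  have hmem (a : α) : a ∈ T.dedup.filter (fun a => a ∈ X) ↔ a ∈ X := by
    simpa using h a
  refine ⟨T.dedup.filter fun a => a ∈ X, (List.filter_sublist).trans T.dedup_sublist, ?_, hmem⟩
  rw [← List.toFinset_card_of_nodup (T.nodup_dedup.filter _), ← Set.ncard_coe_finset]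
  congr 1
  ext a
  simpa using h a

/-- A coded counterexample gives a counterexample in the coded structure. -/
theorem IsCounterexample.not_kCoherentFor [∀ n, IsEmpty (L.Functions (n + 1))]
    [Encodable L.Constants] [Encodable (Σ r, L.Relations r)] {ρ : ℕ → ℕ → Prop}
    {φ : DFormula L} (hφ : φ.IsUniversal) {k : ℕ} {w : ModelCode × ℕ × List (List ℕ)}
    (hw : IsCounterexample ρ (Nat.pair φ.code k) w) : ¬ KCoherentFor.{u} ρ φ k := by
  obtain ⟨M, b, T⟩ := w
  simp only [IsCounterexample, Nat.unpair_pair] at hw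
  obtain ⟨hb, hT, hS, hnot⟩ := hw
  let _ : L.Structure (ULift.{u} (Fin (M.1 + 1))) := codedStructure M
  let d : ℕ → ULift.{u} (Fin (M.1 + 1)) := fun n => ⟨Fin.ofNat (M.1 + 1) n⟩
  have hsat {X : Set (List ℕ)} (hX : ∀ l ∈ X, l ∈ T) :
      Sat φ (toAssignment d φ.freeVars '' X) ↔
        ∃ G ∈ goodTeams M (tuples M.1 b) φ.code, ∀ l ∈ X, l ∈ G :=
    (satIn_univ hφ).symm.trans (satIn_iff_exists_goodTeams hφ hb
      (describes_codedStructure M _ _) (fun l hl => hT (hX l hl)) (teamMatches_image d _ X))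
  intro hcoh
  refine hnot ((hsat (X := {l | l ∈ T}) fun l hl => hl).1
    ((hcoh _ (toAssignment d φ.freeVars '' {l | l ∈ T}) ?_).2 ?_))
  · rintro _ ⟨l, -, rfl⟩ x
    simp [toAssignment]
  · intro S hST hfin hcard
    -- Distinct lists may describe the same assignment: one preimage is chosen for each element.
    obtain ⟨X, hXT, hX⟩ := Set.SurjOn.exists_bijOn_subset hST
    have hXS : X.ncard = S.ncard := by
      rw [← hX.image_eq, Set.InjOn.ncard_image hX.injOn]
    obtain ⟨S', hS', hlen, hmem⟩ := exists_sublist_of_subset hXT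
    obtain ⟨G, hG, hSG⟩ := hS S' (List.mem_sublists'.2 hS') (by rwa [hlen, hXS])
    rw [← hX.image_eq]
    exact (hsat hXT).2 ⟨G, hG, fun l hl => hSG ((hmem l).2 hl)⟩

theorem exists_enumeration {A : Type u} {B : Finset A} (hB : B.Nonempty) :
    ∃ (N : ℕ) (d : ℕ → A), d '' Set.Iic N = B ∧ Set.InjOn d (Set.Iic N) := by
  obtain ⟨N, hN⟩ := Nat.exists_eq_succ_of_ne_zero hB.card_pos.ne'
  let e := B.equivFinOfCardEq hN
  refine ⟨N, fun n => (e.symm (Fin.ofNat (N + 1) n)).val, ?_, fun m hm n hn h => ?_⟩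
  · ext a
    constructor
    · rintro ⟨n, -, rfl⟩
      exact Subtype.coe_prop _
    · intro ha
      refine ⟨(e ⟨a, ha⟩).val, Nat.lt_succ_iff.1 (e ⟨a, ha⟩).isLt, ?_⟩
      simp
  · have h' := congrArg Fin.val (e.symm.injective (Subtype.ext h))
    simpa [Nat.mod_eq_of_lt (Nat.lt_succ_iff.2 hm), Nat.mod_eq_of_lt (Nat.lt_succ_iff.2 hn)]
      using h'

theorem exists_list_getD_encode {α : Type*} [Encodable α] (cs : List α) (f : α → ℕ) :
    ∃ cl : List ℕ, ∀ c ∈ cs, cl.getD (encode c) 0 = f c := by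
  refine ⟨(List.range ((cs.map encode).sum + 1)).map fun e =>
    ((decode e : Option α).map f).getD 0, fun c hc => ?_⟩
  have : encode c < (cs.map encode).sum + 1 :=
    Nat.lt_succ_iff.2 (List.le_sum_of_mem (List.mem_map_of_mem hc))
  simp [this]

theorem exists_list_atoms {α : Type*} [Encodable α] (ar : α → ℕ) (rs : List α) (N : ℕ)
    (P : ∀ R : α, (Fin (ar R) → ℕ) → Prop) :
    ∃ D : List (ℕ × List ℕ), ∀ R ∈ rs, ∀ v : Fin (ar R) → ℕ, (∀ i, v i ≤ N) →
      (P R v ↔ (encode R, List.ofFn v) ∈ D) := by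
  classical
  refine ⟨rs.flatMap fun R => ((tuples N (ar R)).filter fun l =>
    ∃ v, l = List.ofFn v ∧ P R v).map fun l => (encode R, l), fun R hR v hv => ?_⟩
  simp only [List.mem_flatMap, List.mem_map, List.mem_filter, decide_eq_true_eq, Prod.mk.injEq,
    encode_inj]
  constructor
  · intro h
    refine ⟨R, hR, List.ofFn v, ⟨mem_tuples.2 ⟨List.length_ofFn, fun a ha => ?_⟩, v, rfl, h⟩,
      rfl, rfl⟩
    obtain ⟨i, rfl⟩ := List.mem_ofFn.1 ha
    exact hv i
  · rintro ⟨R', -, _, ⟨-, v', rfl, h⟩, rfl, hv'⟩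
    rwa [← List.ofFn_injective hv']

/-- Every finite nonempty part of a structure has a code, as far as finitely many relation symbols
and constants with values in that part are concerned. -/
theorem exists_describes [Encodable L.Constants] [Encodable (Σ r, L.Relations r)] {A : Type u}
    [L.Structure A] {B : Finset A} (hB : B.Nonempty) (cs : List L.Constants)
    (hc : ∀ c ∈ cs, (c : A) ∈ B) (rs : List (Σ r, L.Relations r)) :
    ∃ (M : ModelCode) (d : ℕ → A), Describes M d B cs rs := by
  obtain ⟨N, d, himage, hinj⟩ := exists_enumeration hB
  have hex : ∀ c : L.Constants, ∃ n, c ∈ cs → n ≤ N ∧ d n = c := fun c => by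
    by_cases h : c ∈ cs
    · obtain ⟨n, hn⟩ := himage.superset (hc c h)
      exact ⟨n, fun _ => hn⟩
    · exact ⟨0, fun h' => (h h').elim⟩
  choose f hf using hex
  obtain ⟨cl, hcl⟩ := exists_list_getD_encode cs f
  obtain ⟨D, hD⟩ := exists_list_atoms (fun R : Σ r, L.Relations r => R.1) rs N
    fun R v => FirstOrder.Language.Structure.RelMap R.2 (d ∘ v)
  refine ⟨(N, cl, D), d, himage, hinj, fun c h => ?_, hD⟩
  rw [hcl c h, min_eq_left (hf c h).1, (hf c h).2]

theorem exists_matches_mem_tuples {A : Type u} {N : ℕ} {d : ℕ → A} {B : Set A}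
    (himage : d '' Set.Iic N = B) {V : Finset Var} {b : ℕ} (hb : ∀ x ∈ V, x < b)
    {s : Assignment A} (hV : ∀ x, (s x).isSome ↔ x ∈ V) (hs : ∀ x, ∀ a ∈ s x, a ∈ B) :
    ∃ l ∈ tuples N b, Matches d V s l := by
  have hex : ∀ x, ∃ n ≤ N, x ∈ V → s x = some (d n) := fun x => by
    by_cases hx : x ∈ V
    · obtain ⟨a, ha⟩ := Option.isSome_iff_exists.1 ((hV x).2 hx)
      obtain ⟨n, hn, rfl⟩ := himage.superset (hs x a ha)
      exact ⟨n, hn, fun _ => ha⟩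
    · exact ⟨0, Nat.zero_le _, fun h => (hx h).elim⟩
  choose f hf hsf using hex
  refine ⟨(List.range b).map f, mem_tuples.2 ⟨by simp, ?_⟩, fun x hx => ?_⟩
  · simp only [List.mem_map]
    rintro _ ⟨x, -, rfl⟩
    exact hf x
  · rw [hsf x hx]
    simp [hb x hx]

/-- A universal formula that is not coherent has a coded counterexample: by compactness its
failure shows in a finite part of the structure, and the relevant subteams of the smaller team
still satisfy the formula because satisfaction passes from the structure to its parts. -/
theorem exists_isCounterexample [Encodable L.Constants] [Encodable (Σ r, L.Relations r)]
    {ρ : ℕ → ℕ → Prop} {φ : DFormula L} (hφ : φ.IsUniversal) {k : ℕ}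
    (h : ¬ KCoherentFor.{u} ρ φ k) : ∃ w, IsCounterexample ρ (Nat.pair φ.code k) w := by
  classical
  simp only [KCoherentFor, not_forall] at h
  obtain ⟨A, hA, _, T, hdom, h⟩ := h
  have hsub : ∀ S ⊆ T, S.Finite → ρ S.ncard k → Sat φ S := by
    by_contra hc
    exact h ⟨fun hT S hS _ _ => hT.mono hφ hS, fun hS => (hc hS).elim⟩
  have hnot : ¬ Sat φ T := fun hT => h ⟨fun _ => hsub, fun _ => hT⟩
  obtain ⟨a₀⟩ := hA
  obtain ⟨B, hB₀, hB⟩ := exists_finset_not_satIn hφ hdom hnot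
    (insert a₀ (φ.consts.map fun c : L.Constants => (c : A)).toFinset)
  obtain ⟨M, d, hM⟩ := exists_describes (B := B) ⟨a₀, hB₀ (Finset.mem_insert_self _ _)⟩ φ.consts
    (fun c hc => hB₀ (Finset.mem_insert_of_mem (List.mem_toFinset.2 (List.mem_map_of_mem hc))))
    φ.rels
  let b := max φ.code (φ.freeVars.sup id) + 1
  have hb : φ.code < b := Nat.lt_succ_iff.2 (le_max_left _ _)
  have hbV : ∀ x ∈ φ.freeVars, x < b := fun x hx =>
    Nat.lt_succ_iff.2 ((Finset.le_sup (f := id) hx).trans (le_max_right _ _))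
  let U : Team A := {s ∈ T | ∀ x, ∀ a ∈ s x, a ∈ B}
  have hex : ∀ s, ∃ l, s ∈ U → l ∈ tuples M.1 b ∧ Matches d φ.freeVars s l := fun s => by
    by_cases hs : s ∈ U
    · obtain ⟨l, hl⟩ := exists_matches_mem_tuples hM.image hbV (hdom s hs.1) hs.2
      exact ⟨l, fun _ => hl⟩
    · exact ⟨[], fun h => (hs h).elim⟩
  choose f hf using hex
  -- Assignments in `U` have domain `φ.freeVars`, on which their lists determine them.
  have hinj : Set.InjOn f U := fun s hs s' hs' hss' => by
    funext x
    by_cases hx : x ∈ φ.freeVars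
    · rw [(hf s hs).2 x hx, (hf s' hs').2 x hx, hss']
    · have hnone {s : Assignment A} (hs : s ∈ U) : s x = none := by
        rw [← Option.not_isSome_iff_eq_none, hdom s hs.1]
        exact hx
      rw [hnone hs, hnone hs']
  have hfU : f '' U ⊆ {l | l ∈ tuples M.1 b} := by
    rintro _ ⟨s, hs, rfl⟩
    exact (hf s hs).1
  have hsat {S : Team A} (hS : S ⊆ U) :
      SatIn (B : Set A) φ S ↔ ∃ G ∈ goodTeams M (tuples M.1 b) φ.code, ∀ l ∈ f '' S, l ∈ G := by
    refine satIn_iff_exists_goodTeams hφ hb hM (fun l hl => hfU (Set.image_mono hS hl)) ⟨?_, ?_⟩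
    · exact fun s hs => ⟨f s, ⟨s, hs, rfl⟩, (hf s (hS hs)).2⟩
    · rintro _ ⟨s, hs, rfl⟩
      exact ⟨s, hs, (hf s (hS hs)).2⟩
  have hfin : (f '' U).Finite := (List.finite_toSet (tuples M.1 b)).subset hfU
  have hmem (l : List ℕ) : l ∈ hfin.toFinset.toList ↔ l ∈ f '' U := by
    rw [Finset.mem_toList, Set.Finite.mem_toFinset]
  refine ⟨(M, b, hfin.toFinset.toList), ?_⟩
  simp only [IsCounterexample, Nat.unpair_pair]
  refine ⟨hb, fun l hl => hfU ((hmem l).1 hl), fun S hS hcard => ?_, ?_⟩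
  · have hsubl := List.mem_sublists'.1 hS
    let S' : Team A := {s ∈ U | f s ∈ S}
    have himage : f '' S' = {l | l ∈ S} := by
      ext l
      constructor
      · rintro ⟨s, hs, rfl⟩
        exact hs.2
      · intro hl
        obtain ⟨s, hs, rfl⟩ := (hmem l).1 (hsubl.subset hl)
        exact ⟨s, ⟨hs, hl⟩, rfl⟩
    have hinj' : Set.InjOn f S' := hinj.mono fun s hs => hs.1
    have hfin' : S'.Finite :=
      Set.Finite.of_finite_image (himage ▸ List.finite_toSet S) hinj'
    have hncard : S'.ncard = S.length := by
      rw [← Set.InjOn.ncard_image hinj', himage,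
        ← List.toFinset_card_of_nodup (hsubl.nodup (Finset.nodup_toList _)),
        ← Set.ncard_coe_finset, List.coe_toFinset]
    have hs := hsub S' (fun s hs => hs.1.1) hfin' (by rwa [hncard])
    obtain ⟨G, hG, hSG⟩ := (hsat fun s hs => hs.1).1
      (((satIn_univ hφ).2 hs).mono (Set.subset_univ _) hφ subset_rfl)
    exact ⟨G, hG, fun l hl => hSG l (himage.superset hl)⟩
  · rintro ⟨G, hG, hUG⟩
    exact hB ((hsat subset_rfl).2 ⟨G, hG, fun l hl => hUG ((hmem l).2 hl)⟩)

/-- For any primitive recursive way of selecting the sizes of subteams, the corresponding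
coherence problem is co-enumerable. -/
theorem isCoRE_coherenceProblem [∀ n, IsEmpty (L.Functions (n + 1))] [Primcodable L.Constants]
    [Primcodable (Σ r, L.Relations r)]
    (harity : Computable fun R : (Σ r, L.Relations r) => R.1) {ρ : ℕ → ℕ → Prop}
    (hρ : PrimrecRel ρ) {C : DFormula L → ℕ → Prop}
    (hC : ∀ φ k, C φ k ↔ KCoherentFor.{u} ρ φ k) :
    IsCoRE (CoherenceProblem (universalFormulas L) C) := by
  have hwf : ComputablePred fun n : ℕ =>
      ¬ (isUniversalCode L n.unpair.1 = true ∧ 1 ≤ n.unpair.2) := by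
    classical
    have h₁ : Computable fun n : ℕ => isUniversalCode L n.unpair.1 :=
      (computable_isUniversalCode harity).comp (Primrec.fst.comp Primrec.unpair).to_comp
    have h₂ : Computable fun n : ℕ => decide (1 ≤ n.unpair.2) :=
      (Primrec.nat_le.decide.comp (Primrec.const 1) (Primrec.snd.comp Primrec.unpair)).to_comp
    refine ComputablePred.computable_iff.2
      ⟨_, Primrec.not.to_comp.comp (Primrec.and.to_comp.comp h₁ h₂), ?_⟩
    funext n
    simp [imp_iff_not_or]
  have hcex : PrimrecPred fun x : ℕ × (ModelCode × ℕ × List (List ℕ)) =>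
      IsCounterexample ρ x.1 x.2 :=
    primrecPred_isCounterexample hρ Primrec.fst (Primrec.fst.comp Primrec.snd)
      (Primrec.fst.comp (Primrec.snd.comp Primrec.snd))
      (Primrec.snd.comp (Primrec.snd.comp Primrec.snd))
  -- A number that is no code of a universal formula may be accepted by `IsCounterexample` without
  -- harm, as it belongs to the complement anyway.
  refine (rePred_or hwf.to_re (rePred_exists hcex)).of_eq fun n => ?_
  rw [← imp_iff_not_or]
  constructor
  · rintro h ⟨φ, hφ, k, hk, hcoh, rfl⟩
    obtain ⟨w, hw⟩ := h (by
      rw [Nat.unpair_pair, isUniversalCode_iff]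
      exact ⟨⟨φ, hφ, rfl⟩, hk⟩)
    exact hw.not_kCoherentFor hφ ((hC φ k).1 hcoh)
  · rintro h ⟨hn, hk⟩
    obtain ⟨φ, hφ, hφn⟩ := isUniversalCode_iff.1 hn
    have hpair : n = Nat.pair φ.code n.unpair.2 := by rw [hφn, Nat.pair_unpair]
    rw [hpair]
    exact exists_isCounterexample hφ fun hcoh => h ⟨φ, hφ, _, hk, (hC φ _).2 hcoh, hpair⟩

end DepLogic

theorem mainTheorem8 (L : FirstOrder.Language.{0, 0}) [∀ n, IsEmpty (L.Functions (n + 1))]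
    [Primcodable L.Constants] [Primcodable (Σ r, L.Relations r)]
    (harity : Computable fun R : (Σ r, L.Relations r) => R.1) :
    DepLogic.IsCoRE
        (DepLogic.CoherenceProblem (DepLogic.universalFormulas L) DepLogic.KCoherent.{u}) ∧
      DepLogic.IsCoRE
        (DepLogic.CoherenceProblem (DepLogic.universalFormulas L)
          DepLogic.KCoherentAtMost.{u}) :=
  ⟨DepLogic.isCoRE_coherenceProblem harity Primrec.eq fun _ _ => DepLogic.kCoherent_iff,
    DepLogic.isCoRE_coherenceProblem harity Primrec.nat_le
      fun _ _ => DepLogic.kCoherentAtMost_iff⟩
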